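/- Let $n\ge 1$ and $k>1$ be integers and let $\mathbb{R}^n_+=\{x\in\mathbb{R}^n:\ x_i>0 \text{ for all } i\}$. Let $\varphi:\mathbb{R}^n_+\to(-\infty,\infty]$ be $(1/k)$-convex, meaning that the function $(x_1,\dots,x_n)\mapsto\varphi(x_1^k,\dots,x_n^k)$ is convex on $\mathbb{R}^n_+$. Let $\mu$ be the Borel measure on $\mathbb{R}^n_+$ with density $\exp(-\varphi)$ with respect to Lebesgue measure, where $\exp(-\infty)=0$; the measure $\mu$ need not be finite. Then for every locally Lipschitz, $\mu$-integrable function $f:\mathbb{R}^n_+\to\mathbb{R}$ with $\int f\,d\mu=0$, $$\int_{\mathbb{R}^n_+} f^2\,d\mu\ \le\ \frac{k^2}{k-1}\sum_{i=1}^n\int_{\mathbb{R}^n_+}x_i^2\,|\partial_i f(x)|^2\,d\mu(x),$$ where $\partial_i f=\partial f/\partial x_i$ (defined almost everywhere) and both sides are understood as elements of $[0,\infty]$. No boundary conditions are imposed on $f$. -/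

import Mathlib

open MeasureTheory

/-- The open orthant of all points of `ℝⁿ` with (strictly) positive coordinates. -/
def orthant (n : ℕ) : Set (Fin n → ℝ) :=
  {x | ∀ i, 0 < x i}

/-- Convexity on a set `s` of a function with values in `(-∞, ∞]` (the value `⊥` is excluded
separately, where the function is introduced). The weights are strictly positive, so no
product `0 * ⊤` occurs. -/
def EConvexOn {n : ℕ} (s : Set (Fin n → ℝ)) (φ : (Fin n → ℝ) → EReal) : Prop :=
  Convex ℝ s ∧ ∀ x ∈ s, ∀ y ∈ s, ∀ a b : ℝ, 0 < a → 0 < b → a + b = 1 →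
    φ (a • x + b • y) ≤ (a : EReal) * φ x + (b : EReal) * φ y

/-- `φ` is `p`-convex (`0 < p ≤ 1`) on the open orthant: the function
`(x₁, …, xₙ) ↦ φ (x₁ ^ (1/p), …, xₙ ^ (1/p))` is convex there. -/
def IsPConvex {n : ℕ} (p : ℝ) (φ : (Fin n → ℝ) → EReal) : Prop :=
  EConvexOn (orthant n) (fun x => φ (fun i => x i ^ (1 / p)))

/-- The measure on the open orthant with density `exp (-φ)` with respect to Lebesgue measure
(`exp (-∞) = 0`). -/
noncomputable def expMeasure {n : ℕ} (φ : (Fin n → ℝ) → EReal) : Measure (Fin n → ℝ) :=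
  (volume.restrict (orthant n)).withDensity (fun x => EReal.exp (-φ x))

/-- The partial derivative of `f` with respect to the `i`-th variable. -/
noncomputable def partialDeriv {n : ℕ} (i : Fin n) (f : (Fin n → ℝ) → ℝ)
    (x : Fin n → ℝ) : ℝ :=
  lineDeriv ℝ f x (Pi.single i 1)

/-! In the coordinates x_i = y_i^k the measure μ has density ∏ k y_i^(k-1) · exp(-ψ(y)) with ψ
convex where it is finite. Each Jacobian factor y_i^(k-1) is strictly log-concave: its negative
logarithm has second derivative (k-1)/y_i². The Brascamp–Lieb inequality therefore bounds the
variance of g(y) = f(x) by (k-1)⁻¹ times the mean of ∑ y_i² (∂_i g)², and y_i ∂_i g = k x_i ∂_i f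
produces the constant k²/(k-1).

Brascamp–Lieb (`brascamp_lieb_diagonal`) comes from the midpoint form of `prekopa_leindler`, so
neither smoothness of ψ nor any boundary condition enters. For ρ e^(εg) and ρ e^(-εg), an admissible
midpoint function is ρ exp(ε² H), where H (`supConvDefect`) maximises increments of g minus a
quadratic cost; as ε → 0 its upper limit is at most half the dual squared gradient. Comparing the ε²
terms gives the variance bound. The modulus of log-concavity it requires follows from (z+h)(z-h) =
z² - h² ≤ z² exp(-h²/z²), see `powDensity_mul_le`.

This needs a finite measure and a bounded Lipschitz g, which hold on boxes away from the coordinate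
hyperplanes and from infinity. Exhausting the orthant by such boxes (`powMeasure_poincare`) gives
the general case, infinite μ included: g is integrable with mean zero, so its integrals over the
boxes tend to zero. -/

/-! ### The Prékopa–Leindler inequality. -/

/-- The one-dimensional Brunn–Minkowski inequality, for midpoints. -/
theorem volume_add_volume_le_of_midpoint_mem {A B C : Set ℝ} (hA : MeasurableSet A)
    (hB : MeasurableSet B) (hA' : A.Nonempty) (hB' : B.Nonempty)
    (h : ∀ x ∈ A, ∀ y ∈ B, (x + y) / 2 ∈ C) : volume A + volume B ≤ 2 * volume C := by
  have key : ∀ K ⊆ A, IsCompact K → K.Nonempty → ∀ L ⊆ B, IsCompact L → L.Nonempty →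
      volume K + volume L ≤ 2 * volume C := by
    intro K hKA hK hKn L hLB hL hLn
    -- With a = max K and b = min L, the translates K + b and a + L both lie in K + L ⊆ 2C and meet
    -- at most in the point a + b.
    obtain ⟨a, haK, ha⟩ := hK.exists_isGreatest hKn
    obtain ⟨b, hbL, hb⟩ := hL.exists_isLeast hLn
    have hC : volume ((fun t : ℝ => 2⁻¹ * t) ⁻¹' C) = 2 * volume C := by
      rw [Real.volume_preimage_mul_left (by norm_num)]
      simp
    have hK1 : volume ((fun x => x + b) '' K) = volume K := by simp
    have hL1 : volume ((fun x => a + x) '' L) = volume L := by simp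
    have hLm : MeasurableSet ((fun x => a + x) '' L) :=
      (hL.image (by fun_prop)).measurableSet
    rw [← hC, ← hK1, ← hL1, ← measure_union₀ hLm.nullMeasurableSet]
    · refine measure_mono ?_
      rintro _ (⟨x, hx, rfl⟩ | ⟨y, hy, rfl⟩)
      · have := h x (hKA hx) b (hLB hbL)
        simpa [div_eq_inv_mul] using this
      · have := h a (hKA haK) y (hLB hy)
        simpa [div_eq_inv_mul] using this
    · refine measure_mono_null (t := {a + b}) ?_ (by simp)
      rintro _ ⟨⟨x, hx, rfl⟩, ⟨y, hy, hxy⟩⟩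
      have h1 := ha hx
      have h2 := hb hy
      simp only at hxy ⊢
      simp only [Set.mem_singleton_iff]
      linarith
  obtain ⟨a, ha⟩ := hA'
  obtain ⟨b, hb⟩ := hB'
  rw [hA.measure_eq_iSup_isCompact, hB.measure_eq_iSup_isCompact]
  simp only [iSup_and']
  refine ENNReal.biSup_add_biSup_le' ⟨∅, by simp, isCompact_empty⟩ ⟨∅, by simp, isCompact_empty⟩ ?_
  rintro K ⟨hKA, hK⟩ L ⟨hLB, hL⟩
  -- The compact sets in the suprema may be empty; inserting a point of each set makes `key`
  -- applicable.
  refine le_trans (add_le_add (measure_mono (Set.subset_insert a K))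
    (measure_mono (Set.subset_insert b L))) (key _ ?_ (hK.insert a) (by simp) _ ?_
    (hL.insert b) (by simp))
  · exact Set.insert_subset ha hKA
  · exact Set.insert_subset hb hLB

theorem lintegral_eq_lintegral_Ioo_meas_lt {u : ℝ → ENNReal} (hu : Measurable u)
    (hu1 : ∀ x, u x ≤ 1) :
    ∫⁻ x, u x = ∫⁻ t in Set.Ioo (0 : ℝ) 1, volume {x | ENNReal.ofReal t < u x} := by
  have hfin : ∀ x, u x ≠ ⊤ := fun x => ne_top_of_le_ne_top ENNReal.one_ne_top (hu1 x)
  have h := lintegral_eq_lintegral_meas_lt (volume : Measure ℝ) (f := fun x => (u x).toReal)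
    (Filter.Eventually.of_forall fun x => ENNReal.toReal_nonneg) hu.ennreal_toReal.aemeasurable
  simp only [ENNReal.ofReal_toReal (hfin _)] at h
  rw [h, ← Set.Ioo_union_Ici_eq_Ioi (zero_lt_one' ℝ), lintegral_union measurableSet_Ici]
  · have h0 : ∫⁻ t in Set.Ici (1 : ℝ), volume {x | t < (u x).toReal} = 0 := by
      rw [setLIntegral_congr_fun (g := fun _ => 0) measurableSet_Ici]
      · simp
      · intro t ht
        have : {x | t < (u x).toReal} = ∅ := by
          ext x
          simp only [Set.mem_ofPred_eq, Set.mem_empty_iff_false, iff_false, not_lt]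
          refine le_trans ?_ ht
          exact ENNReal.toReal_le_of_le_ofReal zero_le_one (by simpa using hu1 x)
        simp [this]
    rw [h0, add_zero]
    refine setLIntegral_congr_fun measurableSet_Ioo ?_
    intro t ht
    simp only [ENNReal.ofReal_lt_iff_lt_toReal ht.1.le (hfin _)]
  · rw [Set.disjoint_left]
    intro x hx hx'
    exact absurd hx.2 (not_lt.2 hx')

theorem ENNReal.mul_le_sq_of_add_le_two_mul {a b c : ENNReal} (h : a + b ≤ 2 * c) :
    a * b ≤ c ^ 2 := by
  rcases eq_or_ne c ⊤ with rfl | hc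
  · simp
  have hab : a + b ≠ ⊤ := ne_top_of_le_ne_top (ENNReal.mul_ne_top (by simp) hc) h
  lift a to NNReal using fun h => hab (by simp [h])
  lift b to NNReal using fun h => hab (by simp [h])
  lift c to NNReal using hc
  norm_cast at h ⊢
  rw [← NNReal.coe_le_coe] at h ⊢
  push_cast at h ⊢
  nlinarith [sq_nonneg ((a : ℝ) - b), a.2, b.2, c.2, mul_self_le_mul_self (by positivity) h]

/-- Since both suprema are 1, the superlevel sets of `u` and `v` are nonempty at the same levels t <
1, and their midpoints lie in that of min(w, 1). Brunn–Minkowski integrated over t gives an additive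
inequality, which AM–GM turns into the product form. -/
theorem prekopa_leindler_real_normalized {u v w : ℝ → ENNReal} (hu : Measurable u)
    (hv : Measurable v) (hw : Measurable w) (hu1 : ⨆ x, u x = 1) (hv1 : ⨆ x, v x = 1)
    (h : ∀ x y, u x * v y ≤ w ((x + y) / 2) ^ 2) :
    (∫⁻ x, u x) * (∫⁻ x, v x) ≤ (∫⁻ x, w x) ^ 2 := by
  have hle : ∀ x, u x ≤ 1 := fun x => hu1 ▸ le_iSup u x
  have hle' : ∀ x, v x ≤ 1 := fun x => hv1 ▸ le_iSup v x
  have hw' : ∫⁻ x, min (w x) 1 ≤ ∫⁻ x, w x := lintegral_mono fun x => min_le_left _ _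
  refine le_trans (ENNReal.mul_le_sq_of_add_le_two_mul (c := ∫⁻ x, min (w x) 1) ?_)
    (pow_le_pow_left' hw' 2)
  have hwm : Measurable fun x => min (w x) 1 := hw.min measurable_const
  have anti : ∀ u : ℝ → ENNReal, Measurable fun t : ℝ => volume {x | ENNReal.ofReal t < u x} := by
    intro u
    refine Antitone.measurable ?_
    intro s t hst
    exact measure_mono fun x hx => lt_of_le_of_lt (ENNReal.ofReal_le_ofReal hst) hx
  rw [lintegral_eq_lintegral_Ioo_meas_lt hu hle, lintegral_eq_lintegral_Ioo_meas_lt hv hle',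
    lintegral_eq_lintegral_Ioo_meas_lt hwm fun x => min_le_right _ _,
    ← lintegral_add_left (anti u), ← lintegral_const_mul _ (anti _)]
  refine setLIntegral_mono' measurableSet_Ioo ?_
  intro t ht
  have ht1 : ENNReal.ofReal t < 1 := by simpa using ht.2
  refine volume_add_volume_le_of_midpoint_mem (measurableSet_lt measurable_const hu)
    (measurableSet_lt measurable_const hv) ?_ ?_ ?_
  · exact lt_iSup_iff.1 (hu1 ▸ ht1)
  · exact lt_iSup_iff.1 (hv1 ▸ ht1)
  · intro x hx y hy
    refine lt_min ?_ ht1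
    have h1 : ENNReal.ofReal t * ENNReal.ofReal t < u x * v y := ENNReal.mul_lt_mul hx hy
    have h2 := lt_of_lt_of_le h1 (h x y)
    rw [← sq] at h2
    exact not_le.1 fun hh => absurd (pow_le_pow_left' hh 2) (not_le.2 h2)

/-- The hypothesis is invariant under dividing `u`, `v`, `w` by A, B and √(AB), which reduces to
suprema equal to 1. -/
theorem prekopa_leindler_real_bounded {u v w : ℝ → ENNReal} (hu : Measurable u)
    (hv : Measurable v) (hw : Measurable w) (hu1 : ⨆ x, u x ≠ ⊤) (hv1 : ⨆ x, v x ≠ ⊤)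
    (h : ∀ x y, u x * v y ≤ w ((x + y) / 2) ^ 2) :
    (∫⁻ x, u x) * (∫⁻ x, v x) ≤ (∫⁻ x, w x) ^ 2 := by
  set A := ⨆ x, u x with hA
  set B := ⨆ x, v x with hB
  rcases eq_or_ne A 0 with hA0 | hA0
  · have : ∀ x, u x = 0 := fun x => le_antisymm (hA0 ▸ le_iSup u x) zero_le
    simp [this]
  rcases eq_or_ne B 0 with hB0 | hB0
  · have : ∀ x, v x = 0 := fun x => le_antisymm (hB0 ▸ le_iSup v x) zero_le
    simp [this]
  obtain ⟨c, hc⟩ : ∃ c : ENNReal, c ^ 2 = A * B :=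
    ⟨(A * B) ^ (1 / 2 : ℝ), by rw [← ENNReal.rpow_natCast, ← ENNReal.rpow_mul]; simp⟩
  have hABt : A * B ≠ ⊤ := ENNReal.mul_ne_top hu1 hv1
  have hAB0 : A * B ≠ 0 := mul_ne_zero hA0 hB0
  have hi : c⁻¹ ^ 2 = A⁻¹ * B⁻¹ := by
    rw [← ENNReal.inv_pow, hc, ENNReal.mul_inv (Or.inl hA0) (Or.inl hu1)]
  have := prekopa_leindler_real_normalized (hu.const_mul A⁻¹) (hv.const_mul B⁻¹)
    (hw.const_mul c⁻¹) (by rw [← ENNReal.mul_iSup, ← hA, ENNReal.inv_mul_cancel hA0 hu1])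
    (by rw [← ENNReal.mul_iSup, ← hB, ENNReal.inv_mul_cancel hB0 hv1])
    (by
      intro x y
      rw [mul_pow, hi, mul_mul_mul_comm]
      gcongr
      exact h x y)
  rw [lintegral_const_mul _ hu, lintegral_const_mul _ hv, lintegral_const_mul _ hw, mul_pow, hi,
    mul_mul_mul_comm, ← ENNReal.mul_inv (Or.inl hA0) (Or.inl hu1)] at this
  exact (ENNReal.mul_le_mul_iff_right (ENNReal.inv_ne_zero.2 hABt) (ENNReal.inv_ne_top.2 hAB0)).1
    this

theorem lintegral_eq_iSup_lintegral_min {α : Type*} [MeasurableSpace α] (μ : Measure α)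
    {u : α → ENNReal} (hu : Measurable u) :
    ∫⁻ x, u x ∂μ = ⨆ m : ℕ, ∫⁻ x, min (u x) m ∂μ := by
  rw [← lintegral_iSup (fun m => hu.min measurable_const)]
  · refine lintegral_congr fun x => ?_
    have := inf_iSup_eq (u x) (fun m : ℕ => (m : ENNReal))
    rw [ENNReal.iSup_natCast, inf_top_eq] at this
    exact this
  · intro m m' h x
    exact min_le_min le_rfl (by exact_mod_cast h)

theorem prekopa_leindler_real {u v w : ℝ → ENNReal} (hu : Measurable u)
    (hv : Measurable v) (hw : Measurable w)
    (h : ∀ x y, u x * v y ≤ w ((x + y) / 2) ^ 2) :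
    (∫⁻ x, u x) * (∫⁻ x, v x) ≤ (∫⁻ x, w x) ^ 2 := by
  rw [lintegral_eq_iSup_lintegral_min _ hu, lintegral_eq_iSup_lintegral_min _ hv]
  simp only [ENNReal.iSup_mul, ENNReal.mul_iSup]
  refine iSup_le fun m => iSup_le fun m' => ?_
  have bd : ∀ (u : ℝ → ENNReal) (m : ℕ), ⨆ x, min (u x) m ≠ ⊤ := fun u m =>
    ne_top_of_le_ne_top (ENNReal.natCast_ne_top m) (iSup_le fun x => min_le_right _ _)
  refine prekopa_leindler_real_bounded (hu.min measurable_const) (hv.min measurable_const) hw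
    (bd _ _) (bd _ _) ?_
  intro x y
  exact le_trans (mul_le_mul' (min_le_left _ _) (min_le_left _ _)) (h x y)

theorem lintegral_pi_fin_succ {n : ℕ} {u : (Fin (n + 1) → ℝ) → ENNReal} (hu : Measurable u) :
    ∫⁻ x, u x = ∫⁻ t : ℝ, ∫⁻ y : Fin n → ℝ, u (Fin.cons t y) := by
  have hp := (volume_preserving_piFinSuccAbove (fun _ : Fin (n + 1) => ℝ) 0).symm
  rw [← hp.lintegral_comp hu, Measure.volume_eq_prod, lintegral_prod]
  · simp [MeasurableEquiv.piFinSuccAbove, Fin.insertNthEquiv]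
  · exact (hu.comp hp.measurable).aemeasurable

theorem measurable_fin_cons {n : ℕ} :
    Measurable fun p : ℝ × (Fin n → ℝ) => (Fin.cons p.1 p.2 : Fin (n + 1) → ℝ) := by
  rw [measurable_pi_iff]
  intro i
  refine Fin.cases ?_ (fun j => ?_) i
  · simpa using measurable_fst
  · simpa [Function.comp_def] using (measurable_pi_apply j).comp measurable_snd

/-- The Prékopa–Leindler inequality in `ℝⁿ`, for midpoints. -/
theorem prekopa_leindler (n : ℕ) {u v w : (Fin n → ℝ) → ENNReal} (hu : Measurable u)
    (hv : Measurable v) (hw : Measurable w)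
    (h : ∀ x y, u x * v y ≤ w ((2⁻¹ : ℝ) • (x + y)) ^ 2) :
    (∫⁻ x, u x) * (∫⁻ x, v x) ≤ (∫⁻ x, w x) ^ 2 := by
  induction n with
  | zero =>
    have e : (volume : Measure (Fin 0 → ℝ)) = Measure.dirac 0 := by
      rw [volume_pi, Measure.pi_of_empty _ 0]
    rw [e, lintegral_dirac, lintegral_dirac, lintegral_dirac]
    simpa using h 0 0
  | succ n ih =>
    rw [lintegral_pi_fin_succ hu, lintegral_pi_fin_succ hv, lintegral_pi_fin_succ hw]
    have sl : ∀ {u : (Fin (n + 1) → ℝ) → ENNReal}, Measurable u → ∀ t : ℝ,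
        Measurable fun y : Fin n → ℝ => u (Fin.cons t y) := fun hu t =>
      hu.comp (measurable_fin_cons.comp measurable_prodMk_left)
    have si : ∀ {u : (Fin (n + 1) → ℝ) → ENNReal}, Measurable u →
        Measurable fun t : ℝ => ∫⁻ y : Fin n → ℝ, u (Fin.cons t y) := fun hu =>
      (hu.comp measurable_fin_cons).lintegral_prod_right'
    -- The marginals in the first coordinate satisfy the one-dimensional hypothesis: this is the
    -- induction hypothesis applied to slices.
    refine prekopa_leindler_real (si hu) (si hv) (si hw) ?_
    intro s t
    refine ih (sl hu s) (sl hv t) (sl hw _) ?_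
    intro x y
    convert h (Fin.cons s x) (Fin.cons t y) using 3
    ext i
    refine Fin.cases ?_ (fun j => ?_) i
    · simp [div_eq_inv_mul]
    · simp [mul_add]

/-! ### Elementary bounds for the exponential. -/

-- The Taylor polynomial times e^(-x) has derivative -(x³/6) e^(-x), hence its maximum 1 at 0. The
-- quadratic polynomial would fail for x < 0; the cubic one is the cheapest global bound exact to
-- second order.
open Filter Topology in
theorem Real.cubic_taylor_le_exp (x : ℝ) : 1 + x + x ^ 2 / 2 + x ^ 3 / 6 ≤ Real.exp x := by
  let F : ℝ → ℝ := fun x => (1 + x + x ^ 2 / 2 + x ^ 3 / 6) * Real.exp (-x)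
  have hF : ∀ x, HasDerivAt F (-(x ^ 3 / 6) * Real.exp (-x)) x := by
    intro x
    have h1 : HasDerivAt (fun x : ℝ => 1 + x + x ^ 2 / 2 + x ^ 3 / 6) (1 + x + x ^ 2 / 2) x := by
      have := (((hasDerivAt_id x).const_add 1).add ((hasDerivAt_pow 2 x).div_const 2)).add
        ((hasDerivAt_pow 3 x).div_const 6)
      refine this.congr_deriv ?_
      simp
      ring
    have h2 : HasDerivAt (fun x : ℝ => Real.exp (-x)) (-Real.exp (-x)) x := by
      simpa using (hasDerivAt_neg x).exp
    refine (h1.mul h2).congr_deriv ?_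
    ring
  have hc : Continuous F := continuous_iff_continuousAt.2 fun x => (hF x).continuousAt
  have h0 : F 0 = 1 := by simp [F]
  have key : F x ≤ 1 := by
    rw [← h0]
    rcases le_total 0 x with hx | hx
    · have : AntitoneOn F (Set.Ici 0) := by
        refine antitoneOn_of_deriv_nonpos (convex_Ici 0) hc.continuousOn
          (fun x _ => (hF x).differentiableAt.differentiableWithinAt) ?_
        intro y hy
        rw [interior_Ici, Set.mem_Ioi] at hy
        rw [(hF y).deriv, neg_mul, neg_nonpos]
        positivity
      exact this (Set.mem_Ici.2 le_rfl) hx hx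
    · have : MonotoneOn F (Set.Iic 0) := by
        refine monotoneOn_of_deriv_nonneg (convex_Iic 0) hc.continuousOn
          (fun x _ => (hF x).differentiableAt.differentiableWithinAt) ?_
        intro y hy
        rw [interior_Iic, Set.mem_Iio] at hy
        rw [(hF y).deriv]
        have : y ^ 3 ≤ 0 := by nlinarith [sq_nonneg y]
        exact mul_nonneg (by linarith) (Real.exp_pos _).le
      exact this hx (Set.mem_Iic.2 le_rfl) hx
  have : F x * Real.exp x = 1 + x + x ^ 2 / 2 + x ^ 3 / 6 := by
    simp only [F]
    rw [mul_assoc, ← Real.exp_add]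
    simp
  nlinarith [Real.exp_pos x]

theorem Real.exp_le_one_add_mul_exp (t : ℝ) : Real.exp t ≤ 1 + t * Real.exp t := by
  have h := Real.add_one_le_exp (-t)
  have h2 : Real.exp (-t) * Real.exp t = 1 := by rw [← Real.exp_add]; simp
  nlinarith [Real.exp_pos t]

/-! ### The Brascamp–Lieb inequality from Prékopa–Leindler. -/

section QuadraticCost

variable {n : ℕ}

/-- The rescaled sup-convolution of the odd part of the increments of `g` with the diagonal
quadratic cost of coefficients `c`. -/
noncomputable def supConvDefect (c : (Fin n → ℝ) → Fin n → ℝ) (g : (Fin n → ℝ) → ℝ) (ε : ℝ)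
    (z : Fin n → ℝ) : ℝ :=
  ⨆ η : Fin n → ℝ, ((g (z + ε • η) - g (z - ε • η)) / (2 * ε) - (∑ i, c z i * η i ^ 2) / 2)

/-- The squared length of the gradient of `g` in the metric dual to the diagonal one of
coefficients `c`. -/
noncomputable def dualGradSq (c : (Fin n → ℝ) → Fin n → ℝ) (g : (Fin n → ℝ) → ℝ)
    (z : Fin n → ℝ) : ℝ :=
  ∑ i, (fderiv ℝ g z (Pi.single i 1)) ^ 2 / c z i

variable {c : (Fin n → ℝ) → Fin n → ℝ} {g : (Fin n → ℝ) → ℝ} {M : NNReal} {c₀ : ℝ}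

theorem mul_norm_sq_le_sum (hc₀ : 0 < c₀) {c : Fin n → ℝ} (hc : ∀ i, c₀ ≤ c i) (η : Fin n → ℝ) :
    c₀ * ‖η‖ ^ 2 ≤ ∑ i, c i * η i ^ 2 := by
  have h1 : ‖η‖ ≤ Real.sqrt (∑ i, η i ^ 2) := by
    rw [pi_norm_le_iff_of_nonneg (Real.sqrt_nonneg _)]
    intro i
    refine Real.le_sqrt_of_sq_le ?_
    rw [Real.norm_eq_abs, sq_abs]
    exact Finset.single_le_sum (f := fun i => η i ^ 2) (fun j _ => sq_nonneg _) (Finset.mem_univ i)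
  have h2 : ‖η‖ ^ 2 ≤ ∑ i, η i ^ 2 := by
    have := pow_le_pow_left₀ (norm_nonneg _) h1 2
    rwa [Real.sq_sqrt (Finset.sum_nonneg fun j _ => sq_nonneg _)] at this
  calc c₀ * ‖η‖ ^ 2 ≤ c₀ * ∑ i, η i ^ 2 := by gcongr
    _ = ∑ i, c₀ * η i ^ 2 := Finset.mul_sum _ _ _
    _ ≤ _ := Finset.sum_le_sum fun i _ => by gcongr; exact hc i

/-- Linear growth from the Lipschitz bound competes with quadratic cost. This yields a bound on the
supremum uniform in ε and z, and makes large η irrelevant. -/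
theorem supConvDefect_term_le (hc₀ : 0 < c₀) (hc : ∀ z i, c₀ ≤ c z i) (hg : LipschitzWith M g)
    {ε : ℝ} (hε : 0 < ε) (z η : Fin n → ℝ) :
    (g (z + ε • η) - g (z - ε • η)) / (2 * ε) - (∑ i, c z i * η i ^ 2) / 2 ≤
      M * ‖η‖ - c₀ / 2 * ‖η‖ ^ 2 := by
  have h1 : g (z + ε • η) - g (z - ε • η) ≤ M * (2 * ε * ‖η‖) := by
    refine le_trans (le_abs_self _) ?_
    rw [← Real.norm_eq_abs]
    refine le_trans (hg.norm_sub_le _ _) ?_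
    have : z + ε • η - (z - ε • η) = (2 * ε) • η := by
      rw [mul_smul, two_smul]; abel
    rw [this, norm_smul, Real.norm_of_nonneg (by positivity)]
  have h2 := mul_norm_sq_le_sum hc₀ (hc z) η
  have h3 : (g (z + ε • η) - g (z - ε • η)) / (2 * ε) ≤ M * ‖η‖ := by
    rw [div_le_iff₀ (by positivity)]
    linarith
  linarith

theorem supConvDefect_term_le' (hc₀ : 0 < c₀) (hc : ∀ z i, c₀ ≤ c z i) (hg : LipschitzWith M g)
    {ε : ℝ} (hε : 0 < ε) (z η : Fin n → ℝ) :
    (g (z + ε • η) - g (z - ε • η)) / (2 * ε) - (∑ i, c z i * η i ^ 2) / 2 ≤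
      M ^ 2 / (2 * c₀) := by
  refine le_trans (supConvDefect_term_le hc₀ hc hg hε z η) ?_
  rw [le_div_iff₀ (by positivity)]
  nlinarith [sq_nonneg (c₀ * ‖η‖ - M)]

theorem bddAbove_supConvDefect (hc₀ : 0 < c₀) (hc : ∀ z i, c₀ ≤ c z i) (hg : LipschitzWith M g)
    {ε : ℝ} (hε : 0 < ε) (z : Fin n → ℝ) :
    BddAbove (Set.range fun η : Fin n → ℝ =>
      (g (z + ε • η) - g (z - ε • η)) / (2 * ε) - (∑ i, c z i * η i ^ 2) / 2) :=
  ⟨M ^ 2 / (2 * c₀), by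
    rintro _ ⟨η, rfl⟩
    exact supConvDefect_term_le' hc₀ hc hg hε z η⟩

theorem supConvDefect_le (hc₀ : 0 < c₀) (hc : ∀ z i, c₀ ≤ c z i) (hg : LipschitzWith M g)
    {ε : ℝ} (hε : 0 < ε) (z : Fin n → ℝ) : supConvDefect c g ε z ≤ M ^ 2 / (2 * c₀) :=
  ciSup_le fun η => supConvDefect_term_le' hc₀ hc hg hε z η

theorem supConvDefect_nonneg (hc₀ : 0 < c₀) (hc : ∀ z i, c₀ ≤ c z i) (hg : LipschitzWith M g)
    {ε : ℝ} (hε : 0 < ε) (z : Fin n → ℝ) : 0 ≤ supConvDefect c g ε z := by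
  simpa [supConvDefect] using le_ciSup (bddAbove_supConvDefect hc₀ hc hg hε z) 0

/-- The supremum is uncountable, so measurability goes through lower semicontinuity. -/
theorem measurable_supConvDefect (hc₀ : 0 < c₀) (hc : ∀ z i, c₀ ≤ c z i)
    (hcc : ∀ i, Continuous fun z => c z i) (hg : LipschitzWith M g) {ε : ℝ} (hε : 0 < ε) :
    Measurable (supConvDefect c g ε) := by
  refine LowerSemicontinuous.measurable ?_
  refine lowerSemicontinuous_ciSup (bddAbove_supConvDefect hc₀ hc hg hε) fun η => ?_
  have := hg.continuous
  exact Continuous.lowerSemicontinuous (by fun_prop)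

/-- The competitor η = h/ε in the supremum, rescaled. -/
theorem exp_increment_le (hc₀ : 0 < c₀) (hc : ∀ z i, c₀ ≤ c z i) (hg : LipschitzWith M g)
    {ε : ℝ} (hε : 0 < ε) (z h : Fin n → ℝ) :
    ε * g (z + h) - ε * g (z - h) - ∑ i, c z i * h i ^ 2 ≤
      2 * (ε ^ 2 * supConvDefect c g ε z) := by
  have := le_ciSup (bddAbove_supConvDefect hc₀ hc hg hε z) (ε⁻¹ • h)
  have e : ∑ i, c z i * (ε⁻¹ • h) i ^ 2 = ε⁻¹ ^ 2 * ∑ i, c z i * h i ^ 2 := by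
    rw [Finset.mul_sum]
    refine Finset.sum_congr rfl fun i _ => ?_
    simp only [Pi.smul_apply, smul_eq_mul]
    ring
  simp only [smul_inv_smul₀ hε.ne'] at this
  rw [e] at this
  calc _ = 2 * (ε ^ 2 * ((g (z + h) - g (z - h)) / (2 * ε)
        - ε⁻¹ ^ 2 * (∑ i, c z i * h i ^ 2) / 2)) := by field_simp
    _ ≤ _ := by
      unfold supConvDefect
      gcongr

theorem dualGradSq_nonneg (hc₀ : 0 < c₀) (hc : ∀ z i, c₀ ≤ c z i) (z : Fin n → ℝ) :
    0 ≤ dualGradSq c g z :=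
  Finset.sum_nonneg fun i _ => div_nonneg (sq_nonneg _) (hc₀.le.trans (hc z i))

theorem dualGradSq_le (hc₀ : 0 < c₀) (hc : ∀ z i, c₀ ≤ c z i) (hg : LipschitzWith M g)
    (z : Fin n → ℝ) : dualGradSq c g z ≤ n * (M ^ 2 / c₀) := by
  have : ∀ i ∈ (Finset.univ : Finset (Fin n)),
      (fderiv ℝ g z (Pi.single i 1)) ^ 2 / c z i ≤ M ^ 2 / c₀ := by
    intro i _
    have h1 : |fderiv ℝ g z (Pi.single i 1)| ≤ M := by
      have h := (fderiv ℝ g z).le_of_opNorm_le (norm_fderiv_le_of_lipschitz ℝ hg)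
        (Pi.single i (1 : ℝ))
      simpa [Pi.norm_single] using h
    have h2 : (fderiv ℝ g z (Pi.single i 1)) ^ 2 ≤ (M : ℝ) ^ 2 := by
      rw [← sq_abs]
      gcongr
    exact div_le_div₀ (by positivity) h2 hc₀ (hc z i)
  simpa [dualGradSq] using Finset.sum_le_sum this

theorem measurable_dualGradSq (hcc : ∀ i, Continuous fun z => c z i) :
    Measurable (dualGradSq c g) := by
  unfold dualGradSq
  refine Finset.measurable_sum _ fun i _ => ?_
  exact ((measurable_fderiv_apply_const ℝ g _).pow_const 2).div (hcc i).measurable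

-- For ‖η‖ ≥ 2M/c₀ the cost beats the Lipschitz bound and the term is nonpositive. On the remaining
-- bounded range, differentiability at `z` replaces the increment by its linear part up to δ,
-- uniformly in η, and completing the square in each coordinate gives the dual norm.
open Filter Topology in
theorem eventually_supConvDefect_le (hc₀ : 0 < c₀) (hc : ∀ z i, c₀ ≤ c z i)
    (hg : LipschitzWith M g) {z : Fin n → ℝ} (hz : DifferentiableAt ℝ g z) {δ : ℝ} (hδ : 0 < δ) :
    ∀ᶠ ε in 𝓝[>] (0 : ℝ), supConvDefect c g ε z ≤ dualGradSq c g z / 2 + δ := by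
  set R : ℝ := 2 * M / c₀ + 1 with hR
  have hR0 : 0 < R := by positivity
  have h1 := (hasFDerivAt_iff_isLittleO_nhds_zero.1 hz.hasFDerivAt).def
    (show 0 < δ / R by positivity)
  obtain ⟨r, hr, hball⟩ := Metric.eventually_nhds_iff.1 h1
  have h2 : ∀ᶠ ε in 𝓝[>] (0 : ℝ), ε < r / R :=
    (eventually_lt_nhds (by positivity)).filter_mono nhdsWithin_le_nhds
  filter_upwards [h2, self_mem_nhdsWithin] with ε hεr hε
  have hε : 0 < ε := hε
  have hG := dualGradSq_nonneg (g := g) hc₀ hc z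
  refine ciSup_le fun η => ?_
  rcases le_or_gt R ‖η‖ with hη | hη
  · refine le_trans (supConvDefect_term_le hc₀ hc hg hε z η) ?_
    have : 2 * M ≤ c₀ * ‖η‖ := by
      have : 2 * M / c₀ ≤ ‖η‖ := by linarith
      rwa [div_le_iff₀' hc₀] at this
    nlinarith [norm_nonneg η]
  · have hs : ‖ε • η‖ < r := by
      rw [norm_smul, Real.norm_of_nonneg hε.le]
      calc ε * ‖η‖ ≤ ε * R := by gcongr
        _ < r := (lt_div_iff₀ hR0).1 hεr
    have hs' : δ / R * ‖ε • η‖ ≤ δ * ε := by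
      rw [norm_smul, Real.norm_of_nonneg hε.le]
      calc δ / R * (ε * ‖η‖) ≤ δ / R * (ε * R) := by gcongr
        _ = δ * ε := by field_simp
    have a1 := hball (y := ε • η) (by simpa using hs)
    have a2 := hball (y := -(ε • η)) (by simpa using hs)
    rw [norm_neg, ← sub_eq_add_neg, Real.norm_eq_abs] at a2
    rw [Real.norm_eq_abs] at a1
    have b1 := (le_abs_self _).trans (a1.trans hs')
    have b2 := (neg_le_abs _).trans (a2.trans hs')
    simp only [map_smul, map_neg, smul_eq_mul] at b1 b2
    have b3 : (g (z + ε • η) - g (z - ε • η)) / (2 * ε) ≤ fderiv ℝ g z η + δ := by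
      rw [div_le_iff₀ (by positivity)]
      linarith
    have b4 : fderiv ℝ g z η - (∑ i, c z i * η i ^ 2) / 2 ≤ dualGradSq c g z / 2 := by
      have e : fderiv ℝ g z η = ∑ i, η i * fderiv ℝ g z (Pi.single i 1) := by
        conv_lhs => rw [pi_eq_sum_univ' η]
        simp only [map_sum, map_smul, smul_eq_mul]
      rw [e, dualGradSq, Finset.sum_div, Finset.sum_div, ← Finset.sum_sub_distrib]
      refine Finset.sum_le_sum fun i _ => ?_
      have hci : 0 < c z i := hc₀.trans_le (hc z i)
      set a := fderiv ℝ g z (Pi.single i 1)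
      have e : a ^ 2 / c z i / 2 - (η i * a - c z i * η i ^ 2 / 2) =
          (c z i * η i - a) ^ 2 / (2 * c z i) := by
        field_simp
        ring
      rw [← sub_nonneg, e]
      positivity
    linarith

-- Pointwise only an upper bound on the limit is known, at almost every point by Rademacher's
-- theorem. Taking the maximum with the expected limit turns it into convergence, so dominated
-- convergence applies.
open Filter Topology in
theorem tendsto_integral_max_supConvDefect (hc₀ : 0 < c₀) (hc : ∀ z i, c₀ ≤ c z i)
    (hcc : ∀ i, Continuous fun z => c z i) (hg : LipschitzWith M g)
    (ν : Measure (Fin n → ℝ)) [IsFiniteMeasure ν] (hν : ν ≪ volume) {ε : ℕ → ℝ}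
    (hε : ∀ j, 0 < ε j) (hε0 : Tendsto ε atTop (𝓝 0)) :
    Tendsto (fun j => ∫ z, max (supConvDefect c g (ε j) z) (dualGradSq c g z / 2) ∂ν) atTop
      (𝓝 (∫ z, dualGradSq c g z / 2 ∂ν)) := by
  have hε' : Tendsto ε atTop (𝓝[>] 0) :=
    tendsto_nhdsWithin_iff.2 ⟨hε0, Eventually.of_forall hε⟩
  refine tendsto_integral_of_dominated_convergence
    (fun _ => max ((M : ℝ) ^ 2 / (2 * c₀)) (n * (M ^ 2 / c₀) / 2)) ?_ (integrable_const _) ?_ ?_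
  · intro j
    exact ((measurable_supConvDefect hc₀ hc hcc hg (hε j)).max
      ((measurable_dualGradSq hcc).div_const 2)).aestronglyMeasurable
  · intro j
    refine Eventually.of_forall fun z => ?_
    rw [Real.norm_of_nonneg (le_max_of_le_left (supConvDefect_nonneg hc₀ hc hg (hε j) z))]
    have := dualGradSq_le hc₀ hc hg z
    exact max_le_max (supConvDefect_le hc₀ hc hg (hε j) z) (by linarith)
  · filter_upwards [hν.ae_le hg.ae_differentiableAt] with z hz
    rw [Metric.tendsto_nhds]
    intro δ hδ
    filter_upwards [hε'.eventually (eventually_supConvDefect_le hc₀ hc hg hz (half_pos hδ))]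
      with j hj
    rw [Real.dist_eq, abs_of_nonneg (sub_nonneg.2 (le_max_right _ _)), sub_lt_iff_lt_add']
    exact max_lt (by linarith) (by linarith)

/-- The Prékopa–Leindler inequality applied to the exponentials of a function and of its
opposite. -/
theorem lintegral_exp_mul_lintegral_exp_neg_le (hc₀ : 0 < c₀) (hc : ∀ z i, c₀ ≤ c z i)
    (hcc : ∀ i, Continuous fun z => c z i) (hg : LipschitzWith M g) {D : Set (Fin n → ℝ)}
    (hD : MeasurableSet D) (hDc : ∀ x ∈ D, ∀ y ∈ D, (2⁻¹ : ℝ) • (x + y) ∈ D)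
    {ρ : (Fin n → ℝ) → ℝ} (hρm : Measurable ρ) (hρ0 : ∀ x, 0 ≤ ρ x)
    (hρ : ∀ x ∈ D, ∀ y ∈ D, ρ x * ρ y ≤ ρ ((2⁻¹ : ℝ) • (x + y)) ^ 2 *
      Real.exp (-∑ i, c ((2⁻¹ : ℝ) • (x + y)) i * ((2⁻¹ : ℝ) • (x - y)) i ^ 2))
    {ε : ℝ} (hε : 0 < ε) :
    (∫⁻ x, ENNReal.ofReal (Real.exp (ε * g x))
        ∂(volume.restrict D).withDensity fun x => ENNReal.ofReal (ρ x)) *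
      (∫⁻ x, ENNReal.ofReal (Real.exp (-(ε * g x)))
        ∂(volume.restrict D).withDensity fun x => ENNReal.ofReal (ρ x)) ≤
      (∫⁻ x, ENNReal.ofReal (Real.exp (ε ^ 2 * supConvDefect c g ε x))
        ∂(volume.restrict D).withDensity fun x => ENNReal.ofReal (ρ x)) ^ 2 := by
  have hgm : Measurable g := hg.continuous.measurable
  have hHm := measurable_supConvDefect hc₀ hc hcc hg hε
  have conv : ∀ F : (Fin n → ℝ) → ℝ, Measurable F →
      ∫⁻ x, ENNReal.ofReal (Real.exp (F x))
        ∂(volume.restrict D).withDensity (fun x => ENNReal.ofReal (ρ x)) =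
      ∫⁻ x, D.indicator (fun x => ENNReal.ofReal (ρ x * Real.exp (F x))) x := by
    intro F hF
    rw [lintegral_withDensity_eq_lintegral_mul _ hρm.ennreal_ofReal
      hF.exp.ennreal_ofReal, lintegral_indicator hD]
    refine lintegral_congr fun x => ?_
    rw [Pi.mul_apply, ENNReal.ofReal_mul (hρ0 x)]
  have meas : ∀ F : (Fin n → ℝ) → ℝ, Measurable F →
      Measurable (D.indicator (fun x => ENNReal.ofReal (ρ x * Real.exp (F x)))) := fun F hF =>
    (hρm.mul hF.exp).ennreal_ofReal.indicator hD
  have m1 : Measurable fun x => ε * g x := hgm.const_mul ε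
  have m3 : Measurable fun x => ε ^ 2 * supConvDefect c g ε x := hHm.const_mul _
  rw [conv _ m1, conv (fun x => -(ε * g x)) m1.neg, conv _ m3]
  refine prekopa_leindler n (meas _ m1) (meas _ m1.neg) (meas _ m3) ?_
  intro x y
  by_cases hx : x ∈ D
  swap
  · simp [hx]
  by_cases hy : y ∈ D
  swap
  · simp [hy]
  rw [Set.indicator_of_mem hx, Set.indicator_of_mem hy, Set.indicator_of_mem (hDc x hx y hy),
    ← ENNReal.ofReal_mul (mul_nonneg (hρ0 x) (Real.exp_pos _).le),
    ← ENNReal.ofReal_pow (mul_nonneg (hρ0 _) (Real.exp_pos _).le)]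
  refine ENNReal.ofReal_le_ofReal ?_
  set z := (2⁻¹ : ℝ) • (x + y) with hz
  set h := (2⁻¹ : ℝ) • (x - y) with hh
  have hxe : x = z + h := by
    ext i
    simp only [hz, hh, Pi.add_apply, Pi.smul_apply, Pi.sub_apply, smul_eq_mul]
    ring
  have hye : y = z - h := by
    ext i
    simp only [hz, hh, Pi.add_apply, Pi.smul_apply, Pi.sub_apply, smul_eq_mul]
    ring
  have key := exp_increment_le hc₀ hc hg hε z h
  rw [← hxe, ← hye] at key
  calc ρ x * Real.exp (ε * g x) * (ρ y * Real.exp (-(ε * g y)))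
      = (ρ x * ρ y) * Real.exp (ε * g x - ε * g y) := by
        rw [sub_eq_add_neg, Real.exp_add]; ring
    _ ≤ (ρ z ^ 2 * Real.exp (-∑ i, c z i * h i ^ 2)) * Real.exp (ε * g x - ε * g y) := by
        exact mul_le_mul_of_nonneg_right (hρ x hx y hy) (Real.exp_pos _).le
    _ = ρ z ^ 2 * Real.exp (ε * g x - ε * g y - ∑ i, c z i * h i ^ 2) := by
        rw [mul_assoc, ← Real.exp_add]; ring_nf
    _ ≤ ρ z ^ 2 * Real.exp (2 * (ε ^ 2 * supConvDefect c g ε z)) := by gcongr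
    _ = _ := by rw [mul_pow, ← Real.exp_nat_mul]; simp

open Filter Topology in
/-- The Brascamp–Lieb variance inequality for a finite measure whose density is log-concave with a
diagonal modulus of convexity. -/
theorem brascamp_lieb_diagonal (hc₀ : 0 < c₀) (hc : ∀ z i, c₀ ≤ c z i)
    (hcc : ∀ i, Continuous fun z => c z i) (hg : LipschitzWith M g) {D : Set (Fin n → ℝ)}
    (hD : MeasurableSet D) (hDc : ∀ x ∈ D, ∀ y ∈ D, (2⁻¹ : ℝ) • (x + y) ∈ D)
    {B : ℝ} (hB : ∀ x ∈ D, |g x| ≤ B)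
    {ρ : (Fin n → ℝ) → ℝ} (hρm : Measurable ρ) (hρ0 : ∀ x, 0 ≤ ρ x)
    (hρ : ∀ x ∈ D, ∀ y ∈ D, ρ x * ρ y ≤ ρ ((2⁻¹ : ℝ) • (x + y)) ^ 2 *
      Real.exp (-∑ i, c ((2⁻¹ : ℝ) • (x + y)) i * ((2⁻¹ : ℝ) • (x - y)) i ^ 2))
    (ν : Measure (Fin n → ℝ)) [IsFiniteMeasure ν]
    (hν : ν = (volume.restrict D).withDensity fun x => ENNReal.ofReal (ρ x)) :
    ν.real Set.univ * ∫ x, g x ^ 2 ∂ν ≤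
      (∫ x, g x ∂ν) ^ 2 + ν.real Set.univ * ∫ x, dualGradSq c g x ∂ν := by
  have hgm : Measurable g := hg.continuous.measurable
  have hac : ν ≪ volume.restrict D := hν ▸ withDensity_absolutelyContinuous _ _
  have hac' : ν ≪ volume := hac.trans Measure.restrict_le_self.absolutelyContinuous
  have hgB : ∀ᵐ x ∂ν, |g x| ≤ B :=
    hac.ae_le ((ae_restrict_iff' hD).2 (Eventually.of_forall hB))
  have int_of : ∀ (F : ℝ → ℝ), Continuous F → Integrable (fun x => F (g x)) ν := by
    intro F hF
    obtain ⟨C, hC⟩ := (isCompact_Icc (a := -B) (b := B)).exists_bound_of_continuousOn hF.continuousOn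
    refine Integrable.of_bound (hF.measurable.comp hgm).aestronglyMeasurable C ?_
    filter_upwards [hgB] with x hx
    exact hC _ (abs_le.1 hx)
  set Z := ν.real Set.univ
  set m := ∫ x, g x ∂ν
  set q := ∫ x, g x ^ 2 ∂ν
  set s := ∫ x, g x ^ 3 ∂ν
  set C : ℝ := (M : ℝ) ^ 2 / (2 * c₀) with hC
  set ε : ℕ → ℝ := fun j => 1 / ((j : ℝ) + 1) with hεdef
  have hε : ∀ j, 0 < ε j := fun j => by positivity
  have hε0 : Tendsto ε atTop (𝓝 0) := tendsto_one_div_add_atTop_nhds_zero_nat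
  set K : ℕ → ℝ := fun j => ∫ z, max (supConvDefect c g (ε j) z) (dualGradSq c g z / 2) ∂ν with hK
  have hKlim : Tendsto K atTop (𝓝 (∫ z, dualGradSq c g z / 2 ∂ν)) :=
    tendsto_integral_max_supConvDefect hc₀ hc hcc hg ν hac' hε hε0
  have lower : ∀ t : ℝ, Z + t * m + t ^ 2 * (q / 2) + t ^ 3 * (s / 6) ≤
      ∫ x, Real.exp (t * g x) ∂ν := by
    intro t
    have i1 : Integrable (fun x => t * g x) ν := int_of (fun y => t * y) (by fun_prop)
    have i2 : Integrable (fun x => t ^ 2 / 2 * g x ^ 2) ν :=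
      int_of (fun y => t ^ 2 / 2 * y ^ 2) (by fun_prop)
    have i3 : Integrable (fun x => t ^ 3 / 6 * g x ^ 3) ν :=
      int_of (fun y => t ^ 3 / 6 * y ^ 3) (by fun_prop)
    have i0 : Integrable (fun _ : Fin n → ℝ => (1 : ℝ)) ν := integrable_const _
    have e : ∫ x, (1 + t * g x + t ^ 2 / 2 * g x ^ 2 + t ^ 3 / 6 * g x ^ 3) ∂ν =
        Z + t * m + t ^ 2 * (q / 2) + t ^ 3 * (s / 6) := by
      rw [integral_add (by exact (i0.add i1).add i2) i3, integral_add (by exact i0.add i1) i2,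
        integral_add i0 i1, integral_const_mul, integral_const_mul, integral_const_mul]
      simp only [integral_const, smul_eq_mul, mul_one]
      ring
    rw [← e]
    refine integral_mono (by exact ((i0.add i1).add i2).add i3)
      (int_of (fun y => Real.exp (t * y)) (by fun_prop)) fun x => ?_
    have := Real.cubic_taylor_le_exp (t * g x)
    simp only
    linarith
  -- Prékopa–Leindler at t = ε j, with both sides expanded, Z² cancelled and t² divided out.
  have ineq : ∀ j, Z * q + ε j ^ 2 * (q ^ 2 / 4) - (m + ε j ^ 2 * (s / 6)) ^ 2 ≤
      2 * Z * (Real.exp (ε j ^ 2 * C) * K j) +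
        ε j ^ 2 * (Real.exp (ε j ^ 2 * C) * K j) ^ 2 := by
    intro j
    set t := ε j
    have ht : 0 < t := hε j
    set J := Real.exp (t ^ 2 * C) * K j
    have hHm := measurable_supConvDefect hc₀ hc hcc hg ht
    have hHle := supConvDefect_le hc₀ hc hg ht
    have hH0 := supConvDefect_nonneg hc₀ hc hg ht
    have hiH : Integrable (fun x => Real.exp (t ^ 2 * supConvDefect c g t x)) ν := by
      refine Integrable.of_bound (hHm.const_mul _).exp.aestronglyMeasurable
        (Real.exp (t ^ 2 * C)) (Eventually.of_forall fun x => ?_)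
      rw [Real.norm_of_nonneg (Real.exp_pos _).le]
      have := hHle x
      gcongr
    have hiK : Integrable (fun z => max (supConvDefect c g t z) (dualGradSq c g z / 2)) ν := by
      refine Integrable.of_bound (hHm.max
        ((measurable_dualGradSq hcc).div_const 2)).aestronglyMeasurable
        (max C (n * (M ^ 2 / c₀) / 2)) (Eventually.of_forall fun z => ?_)
      rw [Real.norm_of_nonneg (le_max_of_le_left (hH0 z))]
      have := dualGradSq_le hc₀ hc hg z
      exact max_le_max (hHle z) (by linarith)
    have upper : ∫ x, Real.exp (t ^ 2 * supConvDefect c g t x) ∂ν ≤ Z + t ^ 2 * J := by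
      have e : ∫ x, (1 + t ^ 2 * Real.exp (t ^ 2 * C) *
          max (supConvDefect c g t x) (dualGradSq c g x / 2)) ∂ν = Z + t ^ 2 * J := by
        rw [integral_add (integrable_const _) (hiK.const_mul _), integral_const_mul]
        simp only [integral_const, smul_eq_mul, mul_one]
        simp only [J, hK, Z]
        ring
      rw [← e]
      refine integral_mono hiH ((integrable_const _).add (hiK.const_mul _)) fun x => ?_
      refine (Real.exp_le_one_add_mul_exp _).trans ?_
      have h1 := hHle x
      have h2 := hH0 x
      simp only [add_le_add_iff_left]
      calc t ^ 2 * supConvDefect c g t x * Real.exp (t ^ 2 * supConvDefect c g t x)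
          ≤ t ^ 2 * max (supConvDefect c g t x) (dualGradSq c g x / 2) *
            Real.exp (t ^ 2 * C) := by
            gcongr
            exact le_max_left _ _
        _ = _ := by ring
    have pl := lintegral_exp_mul_lintegral_exp_neg_le hc₀ hc hcc hg hD hDc hρm hρ0 hρ ht
    rw [← hν, ← ofReal_integral_eq_lintegral_ofReal
        (int_of (fun y => Real.exp (t * y)) (by fun_prop))
        (Eventually.of_forall fun x => (Real.exp_pos _).le),
      ← ofReal_integral_eq_lintegral_ofReal
        (int_of (fun y => Real.exp (-(t * y))) (by fun_prop))
        (Eventually.of_forall fun x => (Real.exp_pos _).le),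
      ← ofReal_integral_eq_lintegral_ofReal hiH
        (Eventually.of_forall fun x => (Real.exp_pos _).le),
      ← ENNReal.ofReal_mul (integral_nonneg fun x => (Real.exp_pos _).le),
      ← ENNReal.ofReal_pow (integral_nonneg fun x => (Real.exp_pos _).le),
      ENNReal.ofReal_le_ofReal_iff (by positivity)] at pl
    have l1 := lower t
    have l2 := lower (-t)
    simp only [neg_mul] at l2
    set a := ∫ x, Real.exp (t * g x) ∂ν
    set b := ∫ x, Real.exp (-(t * g x)) ∂ν
    have ha : 0 ≤ a := integral_nonneg fun x => (Real.exp_pos _).le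
    have hb : 0 ≤ b := integral_nonneg fun x => (Real.exp_pos _).le
    have hU : 0 ≤ ∫ x, Real.exp (t ^ 2 * supConvDefect c g t x) ∂ν :=
      integral_nonneg fun x => (Real.exp_pos _).le
    have hZ : 0 ≤ Z := measureReal_nonneg
    have hq : 0 ≤ q := integral_nonneg fun x => sq_nonneg _
    have hP : 0 ≤ Z + t ^ 2 * (q / 2) := by positivity
    have ab : (Z + t ^ 2 * (q / 2)) ^ 2 - (t * m + t ^ 3 * (s / 6)) ^ 2 ≤ a * b := by
      have p1 : (Z + t ^ 2 * (q / 2)) + (t * m + t ^ 3 * (s / 6)) ≤ a := by linarith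
      have p2 : (Z + t ^ 2 * (q / 2)) - (t * m + t ^ 3 * (s / 6)) ≤ b := by
        refine le_trans (le_of_eq ?_) l2
        ring
      set P := Z + t ^ 2 * (q / 2)
      set N := t * m + t ^ 3 * (s / 6)
      -- The lower bounds P ± N may be negative, but as P ≥ 0 at most one of them is; then their
      -- product is at most 0 ≤ ab.
      rcases le_total 0 (P + N) with h1 | h1
      · rcases le_total 0 (P - N) with h2 | h2
        · have := mul_le_mul p1 p2 h2 ha
          linarith
        · nlinarith [mul_nonneg ha hb, mul_nonneg h1 (neg_nonneg.2 h2)]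
      · have h2 : 0 ≤ P - N := by linarith
        nlinarith [mul_nonneg ha hb, mul_nonneg h2 (neg_nonneg.2 h1)]
    have fin : (Z + t ^ 2 * (q / 2)) ^ 2 - (t * m + t ^ 3 * (s / 6)) ^ 2 ≤ (Z + t ^ 2 * J) ^ 2 :=
      ab.trans (pl.trans (pow_le_pow_left₀ hU upper 2))
    have ht2 : 0 < t ^ 2 := by positivity
    refine le_of_mul_le_mul_left ?_ ht2
    linarith
  have hε2 : Tendsto (fun j => ε j ^ 2) atTop (𝓝 0) := by simpa using hε0.pow 2
  have hJlim : Tendsto (fun j => Real.exp (ε j ^ 2 * C) * K j) atTop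
      (𝓝 (∫ z, dualGradSq c g z / 2 ∂ν)) := by
    have := ((Real.continuous_exp.tendsto _).comp (hε2.mul_const C)).mul hKlim
    simpa [Function.comp_def] using this
  have L := le_of_tendsto_of_tendsto'
    (((hε2.mul_const (q ^ 2 / 4)).const_add (Z * q)).sub
      (((hε2.mul_const (s / 6)).const_add m).pow 2))
    ((hJlim.const_mul (2 * Z)).add (hε2.mul (hJlim.pow 2))) ineq
  rw [integral_div] at L
  linarith

end QuadraticCost

/-! ### Power densities on boxes. -/

/-- Near a point p the function is at most ψ(p) + 1. Prolonging the segment from y through p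
slightly beyond p, convexity at p forces a lower bound on ψ(y), uniform because the prolongation
ratio t depends only on the diameter scale R. -/
theorem ConvexOn.exists_le_of_isBounded {E : Type*} [NormedAddCommGroup E] [NormedSpace ℝ E]
    [FiniteDimensional ℝ E] {D : Set E} {ψ : E → ℝ} (hψ : ConvexOn ℝ D ψ) (hD : IsOpen D)
    {s : Set E} (hsD : s ⊆ D) (hs : Bornology.IsBounded s) : ∃ c, ∀ y ∈ s, c ≤ ψ y := by
  rcases s.eq_empty_or_nonempty with rfl | ⟨p, hps⟩
  · exact ⟨0, by simp⟩
  have hp := hsD hps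
  have hcont := (hψ.continuousOn hD).continuousAt (hD.mem_nhds hp)
  have h1 : ∀ᶠ x in nhds p, x ∈ D ∧ ψ x < ψ p + 1 :=
    (hD.eventually_mem hp).and (hcont.eventually_lt_const (by linarith))
  obtain ⟨r, hr, hball⟩ := Metric.eventually_nhds_iff.1 h1
  obtain ⟨R, hR0, hR⟩ := hs.subset_ball_lt 0 p
  set t := r / (2 * R) with ht
  have ht0 : 0 < t := by positivity
  refine ⟨ψ p - t⁻¹, fun y hy => ?_⟩
  have hyR : ‖y - p‖ < R := by
    have := hR hy
    rwa [Metric.mem_ball, dist_eq_norm] at this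
  have hq := hball (y := p - t • (y - p)) (by
    rw [dist_eq_norm, sub_sub_cancel_left, norm_neg, norm_smul, Real.norm_of_nonneg ht0.le]
    calc t * ‖y - p‖ ≤ t * R := by gcongr
      _ = r / 2 := by rw [ht]; field_simp
      _ < r := by linarith)
  have hc := hψ.2 (hsD hy) hq.1 (show 0 ≤ t / (1 + t) by positivity)
    (show 0 ≤ 1 / (1 + t) by positivity) (by field_simp; ring)
  have e : (t / (1 + t)) • y + (1 / (1 + t)) • (p - t • (y - p)) = p := by
    have : (1 + t) ≠ 0 := by positivity
    rw [smul_sub, smul_smul, smul_sub, div_mul_eq_mul_div, one_mul]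
    have : p = (1 / (1 + t) + t / (1 + t)) • p := by
      rw [← add_div, div_self this, one_smul]
    conv_rhs => rw [this, add_smul]
    abel
  rw [e, smul_eq_mul, smul_eq_mul] at hc
  have h3 : ψ p * (1 + t) ≤ t * ψ y + (ψ p + 1) := by
    have h4 : t / (1 + t) * ψ y + 1 / (1 + t) * ψ (p - t • (y - p)) =
        (t * ψ y + ψ (p - t • (y - p))) / (1 + t) := by ring
    rw [h4, le_div_iff₀ (by positivity)] at hc
    linarith [hq.2]
  have h5 : ψ p - t⁻¹ = (ψ p * t - 1) / t := by field_simp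
  rw [h5, div_le_iff₀ ht0]
  linarith

/-- The open box of all points with coordinates in `(a, b)`. -/
def openBox (n : ℕ) (a b : ℝ) : Set (Fin n → ℝ) :=
  Set.univ.pi fun _ => Set.Ioo a b

theorem isOpen_openBox (n : ℕ) (a b : ℝ) : IsOpen (openBox n a b) :=
  isOpen_set_pi Set.finite_univ fun _ _ => isOpen_Ioo

theorem convex_openBox (n : ℕ) (a b : ℝ) : Convex ℝ (openBox n a b) :=
  convex_pi fun _ _ => convex_Ioo a b

theorem openBox_subset_Icc (n : ℕ) (a b : ℝ) :
    openBox n a b ⊆ Set.Icc (fun _ => a) (fun _ => b) :=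
  fun _ hx => ⟨fun i => (hx i trivial).1.le, fun i => (hx i trivial).2.le⟩

/-- The density, in the coordinates `y` with `x i = y i ^ k`, of a measure of Lebesgue density
`exp (-ψ)` in `y` relative to the Jacobian. -/
noncomputable def powDensity {n : ℕ} (k : ℕ) (D : Set (Fin n → ℝ)) (ψ : (Fin n → ℝ) → ℝ) :
    (Fin n → ℝ) → ℝ :=
  D.indicator fun y => (∏ i, (k : ℝ) * y i ^ (k - 1)) * Real.exp (-ψ y)

section PowDensity

variable {n k : ℕ} {D : Set (Fin n → ℝ)} {ψ : (Fin n → ℝ) → ℝ}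

theorem measurable_powDensity (hD : IsOpen D) (hψ : ConvexOn ℝ D ψ) :
    Measurable (powDensity k D ψ) := by
  classical
  have hc := hψ.continuousOn hD
  unfold powDensity
  rw [← Set.piecewise_eq_indicator]
  refine ContinuousOn.measurable_piecewise ?_ continuousOn_const hD.measurableSet
  exact ContinuousOn.mul (by fun_prop) hc.neg.rexp

theorem powDensity_nonneg (hDo : D ⊆ orthant n) (y : Fin n → ℝ) : 0 ≤ powDensity k D ψ y := by
  refine Set.indicator_nonneg (fun y hy => ?_) y
  have := hDo hy
  exact mul_nonneg (Finset.prod_nonneg fun i _ => by have := this i; positivity)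
    (Real.exp_pos _).le

/-- Here xy = z² - h² = z²(1 - h²/z²) and 1 - s ≤ e^(-s): the modulus of concavity of the logarithm,
with the coefficient taken at the midpoint and no error term. -/
theorem pow_mul_pow_le_exp {x y z h e : ℝ} (j : ℕ) (hz : 0 < z) (hxy : 0 ≤ x * y)
    (hx : x = z + h) (hy : y = z - h) (he : e = j / z ^ 2 * h ^ 2) :
    x ^ j * y ^ j ≤ (z ^ j) ^ 2 * Real.exp (-e) := by
  have h1 : x * y ≤ z ^ 2 * Real.exp (-(h ^ 2 / z ^ 2)) := by
    have := Real.add_one_le_exp (-(h ^ 2 / z ^ 2))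
    calc x * y = z ^ 2 * (-(h ^ 2 / z ^ 2) + 1) := by rw [hx, hy]; field_simp; ring
      _ ≤ _ := by gcongr
  calc x ^ j * y ^ j = (x * y) ^ j := (mul_pow _ _ _).symm
    _ ≤ (z ^ 2 * Real.exp (-(h ^ 2 / z ^ 2))) ^ j := by gcongr
    _ = _ := by
      rw [mul_pow, ← Real.exp_nat_mul, ← pow_mul, ← pow_mul, mul_comm 2 j, he]
      congr 2
      ring

/-- The Jacobian supplies the whole quadratic gain, coordinate by coordinate; ψ contributes only its
midpoint convexity. -/
theorem powDensity_mul_le (hψ : ConvexOn ℝ D ψ) (hDo : D ⊆ orthant n) {c : Fin n → ℝ}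
    {x y : Fin n → ℝ} (hx : x ∈ D) (hy : y ∈ D)
    (hc : ∀ i, c i = ((k - 1 : ℕ) : ℝ) / ((2⁻¹ : ℝ) • (x + y)) i ^ 2) :
    powDensity k D ψ x * powDensity k D ψ y ≤ powDensity k D ψ ((2⁻¹ : ℝ) • (x + y)) ^ 2 *
      Real.exp (-∑ i, c i * ((2⁻¹ : ℝ) • (x - y)) i ^ 2) := by
  have hzD : (2⁻¹ : ℝ) • (x + y) ∈ D := by
    rw [smul_add]
    exact hψ.1 hx hy (by norm_num) (by norm_num) (by norm_num)
  have hψz : 2 * ψ ((2⁻¹ : ℝ) • (x + y)) ≤ ψ x + ψ y := by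
    have := hψ.2 hx hy (show (0 : ℝ) ≤ 2⁻¹ by norm_num) (show (0 : ℝ) ≤ 2⁻¹ by norm_num)
      (by norm_num)
    rw [← smul_add, smul_eq_mul, smul_eq_mul] at this
    linarith
  set z := (2⁻¹ : ℝ) • (x + y) with hz
  set h := (2⁻¹ : ℝ) • (x - y) with hh
  simp only [powDensity, Set.indicator_of_mem hx, Set.indicator_of_mem hy,
    Set.indicator_of_mem hzD]
  have hprod : (∏ i, (k : ℝ) * x i ^ (k - 1)) * (∏ i, (k : ℝ) * y i ^ (k - 1)) ≤
      (∏ i, (k : ℝ) * z i ^ (k - 1)) ^ 2 * Real.exp (-∑ i, c i * h i ^ 2) := by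
    rw [← Finset.sum_neg_distrib, Real.exp_sum, ← Finset.prod_pow, ← Finset.prod_mul_distrib,
      ← Finset.prod_mul_distrib]
    refine Finset.prod_le_prod (fun i _ => ?_) fun i _ => ?_
    · have := hDo hx i
      have := hDo hy i
      positivity
    · have hxi := hDo hx i
      have hyi := hDo hy i
      have key := pow_mul_pow_le_exp (x := x i) (y := y i) (z := z i) (h := h i)
        (e := c i * h i ^ 2) (k - 1) (hDo hzD i) (mul_pos hxi hyi).le
        (by simp [hz, hh]; ring) (by simp [hz, hh]; ring) (by rw [hc i])
      calc (k : ℝ) * x i ^ (k - 1) * (k * y i ^ (k - 1))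
          = (k : ℝ) ^ 2 * (x i ^ (k - 1) * y i ^ (k - 1)) := by ring
        _ ≤ (k : ℝ) ^ 2 * ((z i ^ (k - 1)) ^ 2 * Real.exp (-(c i * h i ^ 2))) := by gcongr
        _ = _ := by ring
  have hP : 0 ≤ (∏ i, (k : ℝ) * x i ^ (k - 1)) * (∏ i, (k : ℝ) * y i ^ (k - 1)) :=
    mul_nonneg (Finset.prod_nonneg fun i _ => by have := hDo hx i; positivity)
      (Finset.prod_nonneg fun i _ => by have := hDo hy i; positivity)
  calc _ = ((∏ i, (k : ℝ) * x i ^ (k - 1)) * (∏ i, (k : ℝ) * y i ^ (k - 1))) *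
        Real.exp (-(ψ x + ψ y)) := by rw [neg_add, Real.exp_add]; ring
    _ ≤ ((∏ i, (k : ℝ) * z i ^ (k - 1)) ^ 2 * Real.exp (-∑ i, c i * h i ^ 2)) *
        Real.exp (-(2 * ψ z)) := by gcongr
    _ = _ := by
      rw [mul_pow, ← Real.exp_nat_mul]
      push_cast
      rw [mul_neg]
      ring

/-- The measure of density `powDensity`. -/
noncomputable def powMeasure {n : ℕ} (k : ℕ) (D : Set (Fin n → ℝ)) (ψ : (Fin n → ℝ) → ℝ) :
    Measure (Fin n → ℝ) :=
  (volume.restrict D).withDensity fun y => ENNReal.ofReal (powDensity k D ψ y)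

theorem powMeasure_restrict {s : Set (Fin n → ℝ)} (hs : MeasurableSet s)
    (hsD : s ⊆ D) : (powMeasure k D ψ).restrict s =
      (volume.restrict s).withDensity fun y => ENNReal.ofReal (powDensity k D ψ y) := by
  rw [powMeasure, restrict_withDensity hs, Measure.restrict_restrict hs,
    Set.inter_eq_left.2 hsD]

theorem powMeasure_restrict_self (hD : IsOpen D) :
    (powMeasure k D ψ).restrict D = powMeasure k D ψ :=
  powMeasure_restrict hD.measurableSet subset_rfl

theorem powMeasure_inter_openBox_lt_top (hD : IsOpen D) (hψ : ConvexOn ℝ D ψ)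
    (hDo : D ⊆ orthant n) (a b : ℝ) : powMeasure k D ψ (D ∩ openBox n a b) < ⊤ := by
  have hbd : Bornology.IsBounded (D ∩ openBox n a b) :=
    (Metric.isBounded_Icc _ _).subset (Set.inter_subset_right.trans (openBox_subset_Icc n a b))
  obtain ⟨c, hc⟩ := hψ.exists_le_of_isBounded hD Set.inter_subset_left hbd
  have hm : MeasurableSet (D ∩ openBox n a b) :=
    hD.measurableSet.inter (isOpen_openBox n a b).measurableSet
  rw [← Measure.restrict_apply_self, powMeasure_restrict hm Set.inter_subset_left,
    withDensity_apply _ hm, Measure.restrict_restrict hm, Set.inter_self]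
  have hle : ∀ y ∈ D ∩ openBox n a b, powDensity k D ψ y ≤
      (∏ _i : Fin n, (k : ℝ) * b ^ (k - 1)) * Real.exp (-c) := by
    intro y hy
    rw [powDensity, Set.indicator_of_mem hy.1]
    have h0 := hDo hy.1
    have h1 : ∏ i, (k : ℝ) * y i ^ (k - 1) ≤ ∏ _i : Fin n, (k : ℝ) * b ^ (k - 1) := by
      refine Finset.prod_le_prod (fun i _ => by have := h0 i; positivity) fun i _ => ?_
      have := (h0 i).le
      have := (hy.2 i trivial).2.le
      gcongr
    have h2 : Real.exp (-ψ y) ≤ Real.exp (-c) := Real.exp_le_exp.2 (neg_le_neg (hc y hy))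
    exact mul_le_mul h1 h2 (Real.exp_pos _).le
      ((Finset.prod_nonneg fun i _ => by have := h0 i; positivity).trans h1)
  calc _ ≤ ∫⁻ _y in D ∩ openBox n a b,
        ENNReal.ofReal ((∏ _i : Fin n, (k : ℝ) * b ^ (k - 1)) * Real.exp (-c)) :=
        setLIntegral_mono' hm fun y hy => ENNReal.ofReal_le_ofReal (hle y hy)
    _ < ⊤ := by
      rw [setLIntegral_const]
      exact ENNReal.mul_lt_top ENNReal.ofReal_lt_top hbd.measure_lt_top

/-- Brascamp–Lieb with 1/c_i = y_i²/(k-1). The squared-mean term stays, since the mean vanishes only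
over the whole domain. -/
theorem powMeasure_variance_le_of_openBox (hk : 1 < k) (hD : IsOpen D) (hψ : ConvexOn ℝ D ψ)
    (hDo : D ⊆ orthant n) {a b : ℝ} (ha : 0 < a) (hab : a ≤ b) {g : (Fin n → ℝ) → ℝ}
    {M : NNReal} (hg : LipschitzOnWith M g (Set.Icc (fun _ => a) (fun _ => b))) :
    ∫⁻ y in D ∩ openBox n a b, ENNReal.ofReal (g y ^ 2) ∂powMeasure k D ψ ≤
      ENNReal.ofReal ((∫ y in D ∩ openBox n a b, g y ∂powMeasure k D ψ) ^ 2 /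
        (powMeasure k D ψ).real (D ∩ openBox n a b)) +
      ENNReal.ofReal (1 / ((k : ℝ) - 1)) * ∑ i, ∫⁻ y in D ∩ openBox n a b,
        ENNReal.ofReal ((y i * fderiv ℝ g y (Pi.single i 1)) ^ 2) ∂powMeasure k D ψ := by
  set s := D ∩ openBox n a b with hs
  have hso : IsOpen s := hD.inter (isOpen_openBox n a b)
  have hsm : MeasurableSet s := hso.measurableSet
  have hsI : s ⊆ Set.Icc (fun _ => a) (fun _ => b) :=
    Set.inter_subset_right.trans (openBox_subset_Icc n a b)
  obtain ⟨G, hG, hgG⟩ := hg.extend_real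
  have hgGs : Set.EqOn g G s := hgG.mono hsI
  have hfin : powMeasure k D ψ s < ⊤ := powMeasure_inter_openBox_lt_top hD hψ hDo a b
  set ν := (powMeasure k D ψ).restrict s with hν
  have : IsFiniteMeasure ν := ⟨by rwa [hν, Measure.restrict_apply_univ]⟩
  have hk' : 0 < (k : ℝ) - 1 := by
    have : (1 : ℝ) < k := by exact_mod_cast hk
    linarith
  have hkc : ((k - 1 : ℕ) : ℝ) = (k : ℝ) - 1 := by
    rw [Nat.cast_sub hk.le, Nat.cast_one]
  -- Clamping z_i to [a, b] makes the coefficients continuous and at least (k-1)/b² everywhere,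
  -- without changing them on `s`.
  set c : (Fin n → ℝ) → Fin n → ℝ := fun z i => ((k : ℝ) - 1) / (max a (min (z i) b)) ^ 2 with hc
  have hb : 0 < b := ha.trans_le hab
  have hcl : ∀ (z : Fin n → ℝ) i, 0 < max a (min (z i) b) := fun z i => lt_max_of_lt_left ha
  have hcs : ∀ z ∈ s, ∀ i, c z i = ((k : ℝ) - 1) / z i ^ 2 := by
    intro z hz i
    have := hz.2 i trivial
    simp only [hc]
    rw [min_eq_left this.2.le, max_eq_right this.1.le]
  have hconv : ∀ x ∈ s, ∀ y ∈ s, (2⁻¹ : ℝ) • (x + y) ∈ s := by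
    intro x hx y hy
    rw [smul_add]
    exact (hψ.1.inter (convex_openBox n a b)) hx hy (by norm_num) (by norm_num) (by norm_num)
  have hGb : ∃ B, ∀ x ∈ s, |G x| ≤ B := by
    obtain ⟨B, hB⟩ := (isCompact_Icc (a := fun _ : Fin n => a)
      (b := fun _ => b)).exists_bound_of_continuousOn hG.continuous.continuousOn
    exact ⟨B, fun x hx => hB x (hsI hx)⟩
  obtain ⟨B, hB⟩ := hGb
  have hc₀ : 0 < ((k : ℝ) - 1) / b ^ 2 := by positivity
  have hcle : ∀ z i, ((k : ℝ) - 1) / b ^ 2 ≤ c z i := by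
    intro z i
    have := hcl z i
    simp only [hc]
    gcongr
    exact max_le hab (min_le_right _ _)
  have hcc : ∀ i, Continuous fun z => c z i := by
    intro i
    simp only [hc]
    refine Continuous.div (by fun_prop) (by fun_prop) fun z => ?_
    exact (pow_pos (hcl z i) 2).ne'
  have bl := brascamp_lieb_diagonal hc₀ hcle hcc hG hsm hconv hB
    (measurable_powDensity (k := k) hD hψ) (powDensity_nonneg hDo)
    (fun x hx y hy => powDensity_mul_le hψ hDo hx.1 hy.1 fun i => by
      rw [hcs _ (hconv x hx y hy) i, hkc]) ν
    (powMeasure_restrict hsm Set.inter_subset_left)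
  have hZ : ν.real Set.univ = (powMeasure k D ψ).real s := by
    rw [hν, measureReal_restrict_apply_univ]
  rcases eq_or_ne ν 0 with hν0 | hν0
  · simp [hν0]
  have hZpos : 0 < (powMeasure k D ψ).real s := by
    rw [← hZ, measureReal_def]
    exact ENNReal.toReal_pos (by simpa using hν0) (measure_ne_top _ _)
  rw [hZ] at bl
  have hsae : ∀ᵐ y ∂ν, y ∈ s := ae_restrict_mem hsm
  have i1 : Integrable (fun y => G y ^ 2) ν := by
    refine Integrable.of_bound (hG.continuous.pow 2).aestronglyMeasurable (B ^ 2) ?_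
    filter_upwards [hsae] with y hy
    rw [norm_pow]
    have := hB y hy
    exact pow_le_pow_left₀ (norm_nonneg _) this 2
  have i2 : Integrable (fun y => dualGradSq c G y) ν := by
    refine Integrable.of_bound (measurable_dualGradSq hcc).aestronglyMeasurable
      (n * (M ^ 2 / (((k : ℝ) - 1) / b ^ 2))) (Filter.Eventually.of_forall fun y => ?_)
    rw [Real.norm_of_nonneg (dualGradSq_nonneg hc₀ hcle y)]
    exact dualGradSq_le hc₀ hcle hG y
  have e1 : ∫⁻ y, ENNReal.ofReal (g y ^ 2) ∂ν = ENNReal.ofReal (∫ y, G y ^ 2 ∂ν) := by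
    rw [ofReal_integral_eq_lintegral_ofReal i1 (Filter.Eventually.of_forall fun y => sq_nonneg _)]
    refine lintegral_congr_ae ?_
    filter_upwards [hsae] with y hy
    rw [hgGs hy]
  have e2 : ∫ y, g y ∂ν = ∫ y, G y ∂ν := by
    refine integral_congr_ae ?_
    filter_upwards [hsae] with y hy
    rw [hgGs hy]
  have e3 : ENNReal.ofReal (∫ y, dualGradSq c G y ∂ν) = ENNReal.ofReal (1 / ((k : ℝ) - 1)) *
      ∑ i, ∫⁻ y, ENNReal.ofReal ((y i * fderiv ℝ g y (Pi.single i 1)) ^ 2) ∂ν := by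
    rw [ofReal_integral_eq_lintegral_ofReal i2
      (Filter.Eventually.of_forall (dualGradSq_nonneg hc₀ hcle))]
    have e4 : ∀ i, ∫⁻ y, ENNReal.ofReal ((y i * fderiv ℝ g y (Pi.single i 1)) ^ 2) ∂ν =
        ∫⁻ y, ENNReal.ofReal ((y i * fderiv ℝ G y (Pi.single i 1)) ^ 2) ∂ν := by
      intro i
      refine lintegral_congr_ae ?_
      filter_upwards [hsae] with y hy
      rw [(hgGs.eventuallyEq_of_mem (hso.mem_nhds hy)).fderiv_eq]
    have hm : ∀ i, Measurable fun y : Fin n → ℝ =>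
        ENNReal.ofReal ((y i * fderiv ℝ G y (Pi.single i 1)) ^ 2) := fun i =>
      (((measurable_pi_apply i).mul (measurable_fderiv_apply_const ℝ G _)).pow_const 2).ennreal_ofReal
    simp only [e4]
    rw [← lintegral_finsetSum _ fun i _ => hm i, ← lintegral_const_mul _
      (Finset.measurable_sum _ fun i _ => hm i)]
    refine lintegral_congr_ae ?_
    filter_upwards [hsae] with y hy
    rw [← ENNReal.ofReal_sum_of_nonneg fun i _ => sq_nonneg _,
      ← ENNReal.ofReal_mul (by positivity), dualGradSq, Finset.mul_sum]
    congr 1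
    refine Finset.sum_congr rfl fun i _ => ?_
    have := hDo hy.1 i
    rw [hcs y hy i]
    field_simp
  rw [e1, e2, ← e3, ← ENNReal.ofReal_add (by positivity)
    (integral_nonneg (dualGradSq_nonneg hc₀ hcle))]
  refine ENNReal.ofReal_le_ofReal ?_
  rw [← sub_le_iff_le_add, le_div_iff₀ hZpos]
  linarith

end PowDensity

/-! ### Passage from boxes to the whole domain. -/

section Exhaustion

variable {n k : ℕ} {D : Set (Fin n → ℝ)} {ψ : (Fin n → ℝ) → ℝ}

theorem monotone_openBox_exhaustion (n : ℕ) :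
    Monotone fun m : ℕ => openBox n (1 / ((m : ℝ) + 1)) (m + 1) := by
  intro m m' h x hx i _
  have hmm : (m : ℝ) ≤ m' := by exact_mod_cast h
  have h1 := hx i trivial
  refine ⟨lt_of_le_of_lt ?_ h1.1, lt_of_lt_of_le h1.2 ?_⟩
  · gcongr
  · gcongr

theorem iUnion_openBox_exhaustion (n : ℕ) :
    ⋃ m : ℕ, openBox n (1 / ((m : ℝ) + 1)) (m + 1) = orthant n := by
  refine Set.Subset.antisymm (Set.iUnion_subset fun m x hx i => ?_) fun x hx => ?_
  · exact lt_trans (by positivity) (hx i trivial).1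
  · have h1 : ∀ i, ∃ m : ℕ, 1 / ((m : ℝ) + 1) < x i := fun i => exists_nat_one_div_lt (hx i)
    have h2 : ∀ i, ∃ m : ℕ, x i < m := fun i => exists_nat_gt (x i)
    choose p hp using h1
    choose q hq using h2
    refine Set.mem_iUnion.2 ⟨∑ i, (p i + q i), fun i _ => ?_⟩
    have hle : p i + q i ≤ ∑ i, (p i + q i) :=
      Finset.single_le_sum (f := fun i => p i + q i) (fun _ _ => Nat.zero_le _) (Finset.mem_univ i)
    have hpl : (p i : ℝ) ≤ (∑ i, (p i + q i) : ℕ) := by exact_mod_cast le_trans (by omega) hle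
    have hql : (q i : ℝ) ≤ (∑ i, (p i + q i) : ℕ) := by exact_mod_cast le_trans (by omega) hle
    constructor
    · refine lt_of_le_of_lt ?_ (hp i)
      gcongr
    · have := hq i
      linarith

open Filter Topology in
theorem powMeasure_poincare (hk : 1 < k) (hD : IsOpen D) (hψ : ConvexOn ℝ D ψ)
    (hDo : D ⊆ orthant n) {g : (Fin n → ℝ) → ℝ}
    (hg : ∀ a b : ℝ, 0 < a → ∃ M, LipschitzOnWith M g (Set.Icc (fun _ => a) (fun _ => b)))
    (hgi : Integrable g (powMeasure k D ψ)) (hg0 : ∫ y, g y ∂powMeasure k D ψ = 0) :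
    ∫⁻ y, ENNReal.ofReal (g y ^ 2) ∂powMeasure k D ψ ≤
      ENNReal.ofReal (1 / ((k : ℝ) - 1)) * ∑ i, ∫⁻ y,
        ENNReal.ofReal ((y i * fderiv ℝ g y (Pi.single i 1)) ^ 2) ∂powMeasure k D ψ := by
  set ν := powMeasure k D ψ with hν
  set s : ℕ → Set (Fin n → ℝ) := fun m => D ∩ openBox n (1 / ((m : ℝ) + 1)) (m + 1) with hs
  have hsm : ∀ m, MeasurableSet (s m) := fun m =>
    hD.measurableSet.inter (isOpen_openBox n _ _).measurableSet
  have hmono : Monotone s := fun m m' h =>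
    Set.inter_subset_inter_right _ (monotone_openBox_exhaustion n h)
  have hU : ⋃ m, s m = D := by
    rw [hs, ← Set.inter_iUnion, iUnion_openBox_exhaustion, Set.inter_eq_left.2 hDo]
  have hνD : ν.restrict D = ν := powMeasure_restrict_self hD
  rcases eq_or_ne ν 0 with h0 | h0
  · simp [h0]
  obtain ⟨m₀, hm₀⟩ : ∃ m, ν (s m) ≠ 0 := by
    by_contra! hcon
    apply h0
    have : ν D = 0 := by rw [← hU]; exact measure_iUnion_null hcon
    rw [← hνD, Measure.restrict_eq_zero, this]
  have hfin : ∀ m, ν (s m) ≠ ⊤ := fun m => (powMeasure_inter_openBox_lt_top hD hψ hDo _ _).ne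
  -- A fixed positive lower bound for the masses of all later boxes, so the squared-mean terms
  -- vanish in the limit even if the total mass is infinite.
  set Z := ν.real (s m₀) with hZ
  have hZpos : 0 < Z := ENNReal.toReal_pos hm₀ (hfin m₀)
  set R := ENNReal.ofReal (1 / ((k : ℝ) - 1)) * ∑ i, ∫⁻ y,
        ENNReal.ofReal ((y i * fderiv ℝ g y (Pi.single i 1)) ^ 2) ∂ν with hR
  have step : ∀ m ≥ m₀, ∫⁻ y in s m, ENNReal.ofReal (g y ^ 2) ∂ν ≤
      ENNReal.ofReal ((∫ y in s m, g y ∂ν) ^ 2 / Z) + R := by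
    intro m hm
    obtain ⟨M, hM⟩ := hg (1 / ((m : ℝ) + 1)) (m + 1) (by positivity)
    refine (powMeasure_variance_le_of_openBox hk hD hψ hDo (by positivity) ?_ hM).trans
      (add_le_add (ENNReal.ofReal_le_ofReal ?_) ?_)
    · rw [div_le_iff₀ (by positivity)]
      have : (0 : ℝ) ≤ m := by positivity
      nlinarith
    · have : Z ≤ ν.real (s m) := measureReal_mono (hmono hm) (hfin m)
      gcongr
    · refine mul_le_mul_right (Finset.sum_le_sum fun i _ => ?_) _
      exact lintegral_mono' Measure.restrict_le_self le_rfl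
  have l1 : Tendsto (fun m => ∫⁻ y in s m, ENNReal.ofReal (g y ^ 2) ∂ν) atTop
      (𝓝 (∫⁻ y, ENNReal.ofReal (g y ^ 2) ∂ν)) := by
    have e : ∫⁻ y, ENNReal.ofReal (g y ^ 2) ∂ν =
        ⨆ m, ∫⁻ y in s m, ENNReal.ofReal (g y ^ 2) ∂ν := by
      conv_lhs => rw [← hνD, ← hU]
      exact setLIntegral_iUnion_of_directed _ hmono.directed_le
    rw [e]
    exact tendsto_atTop_iSup fun m m' h => lintegral_mono_set (hmono h)
  have l2 : Tendsto (fun m => ∫ y in s m, g y ∂ν) atTop (𝓝 0) := by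
    have := tendsto_setIntegral_of_monotone hsm hmono hgi.integrableOn
    rwa [hU, hνD, hg0] at this
  have l3 : Tendsto (fun m => ENNReal.ofReal ((∫ y in s m, g y ∂ν) ^ 2 / Z) + R) atTop (𝓝 R) := by
    have := (ENNReal.tendsto_ofReal ((l2.pow 2).div_const Z)).add_const R
    simpa using this
  exact le_of_tendsto_of_tendsto l1 l3 (eventually_atTop.2 ⟨m₀, step⟩)

end Exhaustion

/-! ### The coordinatewise power map and its inverse. -/

section PowMap

variable {n k : ℕ}

/-- The coordinatewise `k`-th power. -/
def powMap (n k : ℕ) (y : Fin n → ℝ) : Fin n → ℝ := fun i => y i ^ k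

/-- The coordinatewise `k`-th root. -/
noncomputable def rootMap (n k : ℕ) (x : Fin n → ℝ) : Fin n → ℝ := fun i => x i ^ (1 / (k : ℝ))

theorem contDiff_powMap : ContDiff ℝ 1 (powMap n k) :=
  contDiff_pi.2 fun i => (contDiff_apply ℝ ℝ i).pow k

theorem continuous_rootMap : Continuous (rootMap n k) :=
  continuous_pi fun i => (Real.continuous_rpow_const (by positivity)).comp (continuous_apply i)

theorem powMap_mem_orthant {y : Fin n → ℝ} (hy : y ∈ orthant n) : powMap n k y ∈ orthant n :=
  fun i => pow_pos (hy i) k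

theorem rootMap_mem_orthant {x : Fin n → ℝ} (hx : x ∈ orthant n) : rootMap n k x ∈ orthant n :=
  fun i => Real.rpow_pos_of_pos (hx i) _

theorem rootMap_powMap (hk : k ≠ 0) {y : Fin n → ℝ} (hy : y ∈ orthant n) :
    rootMap n k (powMap n k y) = y := by
  ext i
  rw [rootMap, powMap, one_div, Real.pow_rpow_inv_natCast (hy i).le hk]

theorem powMap_rootMap (hk : k ≠ 0) {x : Fin n → ℝ} (hx : x ∈ orthant n) :
    powMap n k (rootMap n k x) = x := by
  ext i
  rw [powMap, rootMap, one_div, Real.rpow_inv_natCast_pow (hx i).le hk]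

theorem injOn_powMap (hk : k ≠ 0) : Set.InjOn (powMap n k) (orthant n) := fun x hx y hy h => by
  rw [← rootMap_powMap hk hx, h, rootMap_powMap hk hy]

theorem image_powMap_orthant (hk : k ≠ 0) : powMap n k '' orthant n = orthant n :=
  Set.Subset.antisymm (Set.image_subset_iff.2 fun _ hy => powMap_mem_orthant hy)
    fun _ hx => ⟨_, rootMap_mem_orthant hx, powMap_rootMap hk hx⟩

theorem isOpen_orthant : IsOpen (orthant n) := by
  have : orthant n = Set.univ.pi fun _ => Set.Ioi 0 := by
    ext x; simp [orthant]
  rw [this]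
  exact isOpen_set_pi Set.finite_univ fun _ _ => isOpen_Ioi

/-- The derivative of `powMap`. -/
noncomputable def powMapDeriv (n k : ℕ) (y : Fin n → ℝ) : (Fin n → ℝ) →L[ℝ] (Fin n → ℝ) :=
  ContinuousLinearMap.pi fun i => (((k : ℝ) * y i ^ (k - 1)) • ContinuousLinearMap.id ℝ ℝ).comp
    (ContinuousLinearMap.proj i)

theorem hasFDerivAt_powMap (y : Fin n → ℝ) : HasFDerivAt (powMap n k) (powMapDeriv n k y) y := by
  rw [hasFDerivAt_pi']
  intro i
  have h : HasFDerivAt (fun x : Fin n → ℝ => x i) (ContinuousLinearMap.proj i) y :=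
    (ContinuousLinearMap.proj (R := ℝ) (φ := fun _ : Fin n => ℝ) i).hasFDerivAt
  refine (h.pow k).congr_fderiv ?_
  ext v
  simp [powMapDeriv]

theorem det_powMapDeriv (y : Fin n → ℝ) :
    (powMapDeriv n k y).det = ∏ i, (k : ℝ) * y i ^ (k - 1) := by
  rw [powMapDeriv, ContinuousLinearMap.det_pi]
  refine Finset.prod_congr rfl fun i _ => ?_
  simp [ContinuousLinearMap.det]

/-- The line through x in direction e_i pulls back under the root map to a curve through y with
velocity σ e_i, where k x_i σ = y_i. Thus only differentiability of the composite at y is needed. -/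
theorem lineDeriv_comp_rootMap (hk : k ≠ 0) {f : (Fin n → ℝ) → ℝ} {y : Fin n → ℝ}
    (hy : y ∈ orthant n) (hd : DifferentiableAt ℝ (fun y => f (powMap n k y)) y) (i : Fin n) :
    y i * fderiv ℝ (fun y => f (powMap n k y)) y (Pi.single i 1) =
      k * (powMap n k y i * partialDeriv i f (powMap n k y)) := by
  set x := powMap n k y with hx
  have hxo : x ∈ orthant n := powMap_mem_orthant hy
  have hk0 : (k : ℝ) ≠ 0 := by exact_mod_cast hk
  set σ : ℝ := 1 / (k : ℝ) * x i ^ (1 / (k : ℝ) - 1) with hσ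
  have hσy : (k : ℝ) * x i * σ = y i := by
    have h1 : x i ^ (1 / (k : ℝ) - 1) = y i / x i := by
      rw [Real.rpow_sub_one (hxo i).ne', ← congrFun (rootMap_powMap hk hy) i]
      rfl
    have := (hxo i).ne'
    rw [hσ, h1]
    field_simp
  have hcurve : HasDerivAt (fun t : ℝ => rootMap n k (x + t • Pi.single i 1))
      (σ • Pi.single i (1 : ℝ)) 0 := by
    rw [hasDerivAt_pi]
    intro j
    have h1 : HasDerivAt (fun t : ℝ => x j + t * (Pi.single i (1 : ℝ) : Fin n → ℝ) j)
        ((Pi.single i (1 : ℝ) : Fin n → ℝ) j) 0 := by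
      simpa using ((hasDerivAt_id (0 : ℝ)).mul_const
        ((Pi.single i (1 : ℝ) : Fin n → ℝ) j)).const_add (x j)
    have h2 := h1.rpow_const (p := 1 / (k : ℝ)) (Or.inl (by simpa using (hxo j).ne'))
    refine h2.congr_deriv ?_
    by_cases hji : j = i
    · subst hji
      simp [hσ]
    · simp [hji]
  have hroot0 : rootMap n k (x + (0 : ℝ) • Pi.single i 1) = y := by
    rw [zero_smul, add_zero, hx, rootMap_powMap hk hy]
  have hcomp := HasFDerivAt.comp_hasDerivAt (0 : ℝ)
    (by rw [hroot0]; exact hd.hasFDerivAt) hcurve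
  have hev : (fun t : ℝ => f (x + t • Pi.single i 1)) =ᶠ[nhds 0]
      (fun y => f (powMap n k y)) ∘ fun t : ℝ => rootMap n k (x + t • Pi.single i 1) := by
    have hc : ContinuousAt (fun t : ℝ => x + t • (Pi.single i 1 : Fin n → ℝ)) 0 := by fun_prop
    have hmem : ∀ᶠ t : ℝ in nhds 0, x + t • (Pi.single i 1 : Fin n → ℝ) ∈ orthant n :=
      hc.eventually_mem (isOpen_orthant.mem_nhds (by simpa using hxo))
    filter_upwards [hmem] with t ht
    rw [Function.comp_apply, powMap_rootMap hk ht]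
  have hline : partialDeriv i f x =
      σ * fderiv ℝ (fun y => f (powMap n k y)) y (Pi.single i 1) := by
    rw [partialDeriv, lineDeriv, hev.deriv_eq, hcomp.deriv, map_smul, smul_eq_mul]
  rw [hline, ← hσy]
  ring

end PowMap

/-! ### Transport of the measure to the new coordinates. -/

section ChangeOfVariables

variable {n k : ℕ} {φ : (Fin n → ℝ) → EReal}

/-- The interior of the effective domain of `φ` in the coordinates `y` with `x i = y i ^ k`. -/
def powDomain (k : ℕ) (φ : (Fin n → ℝ) → EReal) : Set (Fin n → ℝ) :=
  interior {y | y ∈ orthant n ∧ φ (powMap n k y) < ⊤}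

theorem powDomain_subset_orthant : powDomain k φ ⊆ orthant n :=
  interior_subset.trans fun _ hy => hy.1

theorem IsPConvex.powMap_convex (hφ : IsPConvex (1 / (k : ℝ)) φ) :
    EConvexOn (orthant n) fun y => φ (powMap n k y) := by
  have : ∀ y : Fin n → ℝ, (fun i => y i ^ (1 / (1 / (k : ℝ)))) = powMap n k y := by
    intro y
    ext i
    simp [powMap]
  simpa only [IsPConvex, this] using hφ

theorem convex_effectiveDomain (hφ : IsPConvex (1 / (k : ℝ)) φ)
    (hφ_bot : ∀ x ∈ orthant n, φ x ≠ ⊥) :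
    Convex ℝ {y | y ∈ orthant n ∧ φ (powMap n k y) < ⊤} := by
  rw [convex_iff_forall_pos]
  intro x hx y hy a b ha hb hab
  obtain ⟨hc1, hc2⟩ := hφ.powMap_convex
  refine ⟨hc1 hx.1 hy.1 ha.le hb.le hab, lt_of_le_of_lt (hc2 x hx.1 y hy.1 a b ha hb hab) ?_⟩
  have h1 := hφ_bot _ (powMap_mem_orthant (k := k) hx.1)
  have h2 := hφ_bot _ (powMap_mem_orthant (k := k) hy.1)
  lift φ (powMap n k x) to ℝ using ⟨hx.2.ne, h1⟩ with r1
  lift φ (powMap n k y) to ℝ using ⟨hy.2.ne, h2⟩ with r2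
  exact_mod_cast EReal.coe_lt_top (a * r1 + b * r2)

theorem coe_toReal_of_mem_powDomain (hφ_bot : ∀ x ∈ orthant n, φ x ≠ ⊥) {y : Fin n → ℝ}
    (hy : y ∈ powDomain k φ) :
    ((φ (powMap n k y)).toReal : EReal) = φ (powMap n k y) :=
  EReal.coe_toReal (interior_subset hy).2.ne (hφ_bot _ (powMap_mem_orthant (interior_subset hy).1))

theorem convexOn_toReal (hφ : IsPConvex (1 / (k : ℝ)) φ) (hφ_bot : ∀ x ∈ orthant n, φ x ≠ ⊥) :
    ConvexOn ℝ (powDomain k φ) fun y => (φ (powMap n k y)).toReal := by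
  have hc := (convex_effectiveDomain hφ hφ_bot).interior
  rw [convexOn_iff_forall_pos]
  refine ⟨hc, fun x hx y hy a b ha hb hab => ?_⟩
  have h := hφ.powMap_convex.2 x (powDomain_subset_orthant hx) y (powDomain_subset_orthant hy)
    a b ha hb hab
  simp only at h
  rw [← coe_toReal_of_mem_powDomain hφ_bot hx, ← coe_toReal_of_mem_powDomain hφ_bot hy,
    ← coe_toReal_of_mem_powDomain hφ_bot (hc hx hy ha.le hb.le hab)] at h
  exact_mod_cast h

/-- The frontier of a convex set is Lebesgue-null, so nothing is lost by working in the interior,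
where ψ is continuous. -/
theorem volume_effectiveDomain_diff (hφ : IsPConvex (1 / (k : ℝ)) φ)
    (hφ_bot : ∀ x ∈ orthant n, φ x ≠ ⊥) :
    volume ({y | y ∈ orthant n ∧ φ (powMap n k y) < ⊤} \ powDomain k φ) = 0 :=
  measure_mono_null (Set.sdiff_subset_sdiff_left subset_closure)
    ((convex_effectiveDomain hφ hφ_bot).addHaar_frontier volume)

/-- Measurability of `φ` is not assumed but comes from convexity: `φ` is continuous on the image of
`powDomain`, the image of the null remainder is null, and elsewhere in the orthant the density is
exp(-∞) = 0. -/
theorem aemeasurable_exp_neg (hk : k ≠ 0) (hφ : IsPConvex (1 / (k : ℝ)) φ)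
    (hφ_bot : ∀ x ∈ orthant n, φ x ≠ ⊥) :
    AEMeasurable (fun x => EReal.exp (-φ x)) (volume.restrict (orthant n)) := by
  classical
  have hDo : powDomain k φ ⊆ orthant n := powDomain_subset_orthant
  set E := powMap n k '' powDomain k φ with hE
  have hEm : MeasurableSet E := isOpen_interior.measurableSet.image_of_continuousOn_injOn
    contDiff_powMap.continuous.continuousOn ((injOn_powMap hk).mono hDo)
  have hroot : Set.MapsTo (rootMap n k) E (powDomain k φ) := by
    rintro _ ⟨y, hy, rfl⟩
    rwa [rootMap_powMap hk (hDo hy)]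
  have hcont : ContinuousOn (fun x => ENNReal.ofReal
      (Real.exp (-(φ (powMap n k (rootMap n k x))).toReal))) E := by
    refine ENNReal.continuous_ofReal.comp_continuousOn (ContinuousOn.rexp (ContinuousOn.neg ?_))
    exact ((convexOn_toReal hφ hφ_bot).continuousOn isOpen_interior).comp
      continuous_rootMap.continuousOn hroot
  refine ⟨E.piecewise (fun x => ENNReal.ofReal
    (Real.exp (-(φ (powMap n k (rootMap n k x))).toReal))) 0,
    hcont.measurable_piecewise continuousOn_const hEm, ?_⟩
  have hnull : volume (powMap n k ''
      ({y | y ∈ orthant n ∧ φ (powMap n k y) < ⊤} \ powDomain k φ)) = 0 :=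
    addHaar_image_eq_zero_of_differentiableOn_of_addHaar_eq_zero _
      (contDiff_powMap.differentiable (by simp)).differentiableOn
      (volume_effectiveDomain_diff hφ hφ_bot)
  rw [Filter.EventuallyEq, ae_restrict_iff' isOpen_orthant.measurableSet]
  filter_upwards [measure_eq_zero_iff_ae_notMem.1 hnull] with x hx hxo
  by_cases hxE : x ∈ E
  · rw [Set.piecewise_eq_of_mem _ _ _ hxE, powMap_rootMap hk hxo, ← EReal.exp_coe, EReal.coe_neg]
    have := coe_toReal_of_mem_powDomain hφ_bot (hroot hxE)
    rw [powMap_rootMap hk hxo] at this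
    rw [this]
  · rw [Set.piecewise_eq_of_notMem _ _ _ hxE]
    have hroot' := powMap_rootMap hk hxo
    have : φ x = ⊤ := by
      by_contra hne
      refine hx ⟨rootMap n k x, ⟨⟨rootMap_mem_orthant hxo, ?_⟩, fun hD => ?_⟩, hroot'⟩
      · rw [hroot']
        exact lt_top_iff_ne_top.2 hne
      · exact hxE ⟨_, hD, hroot'⟩
    simp [this]

/-- Stated for arbitrary `F`, so that it applies to the partial derivatives of f without a
measurability proof. -/
theorem lintegral_expMeasure (hk : 1 < k) (hφ : IsPConvex (1 / (k : ℝ)) φ)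
    (hφ_bot : ∀ x ∈ orthant n, φ x ≠ ⊥) (F : (Fin n → ℝ) → ENNReal) :
    ∫⁻ x, F x ∂expMeasure φ = ∫⁻ y, F (powMap n k y)
      ∂powMeasure k (powDomain k φ) fun y => (φ (powMap n k y)).toReal := by
  have hk0 : k ≠ 0 := by omega
  have hψ := convexOn_toReal hφ hφ_bot
  have hDm : MeasurableSet (powDomain k φ) := isOpen_interior.measurableSet
  have hDo : powDomain k φ ⊆ orthant n := powDomain_subset_orthant
  rw [expMeasure, lintegral_withDensity_eq_lintegral_mul_non_measurable₀ _
      (aemeasurable_exp_neg hk0 hφ hφ_bot), powMeasure,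
    lintegral_withDensity_eq_lintegral_mul_non_measurable₀ _
      (measurable_powDensity (D := powDomain k φ) isOpen_interior hψ).ennreal_ofReal.aemeasurable
      (Filter.Eventually.of_forall fun _ => ENNReal.ofReal_lt_top)]
  swap
  · refine (ae_restrict_iff' isOpen_orthant.measurableSet).2 (Filter.Eventually.of_forall ?_)
    intro x hx
    rw [EReal.exp_lt_top_iff, lt_top_iff_ne_top, Ne, EReal.neg_eq_top_iff]
    exact hφ_bot x hx
  have e0 := lintegral_image_eq_lintegral_abs_det_fderiv_mul volume
    isOpen_orthant.measurableSet
    (fun y _ => (hasFDerivAt_powMap (k := k) y).hasFDerivWithinAt) (injOn_powMap (n := n) hk0)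
    ((fun x => EReal.exp (-φ x)) * F)
  rw [image_powMap_orthant hk0] at e0
  rw [e0, ← lintegral_indicator isOpen_orthant.measurableSet, ← lintegral_indicator hDm]
  refine lintegral_congr_ae ?_
  filter_upwards [measure_eq_zero_iff_ae_notMem.1 (volume_effectiveDomain_diff hφ hφ_bot)] with y hy
  by_cases hyD : y ∈ powDomain k φ
  · have hyo := hDo hyD
    have hprod : 0 ≤ ∏ i, (k : ℝ) * y i ^ (k - 1) :=
      Finset.prod_nonneg fun i _ => by have := hyo i; positivity
    rw [Set.indicator_of_mem hyD, Set.indicator_of_mem hyo, Pi.mul_apply, Pi.mul_apply, powDensity,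
      Set.indicator_of_mem hyD, det_powMapDeriv, abs_of_nonneg hprod, ENNReal.ofReal_mul hprod,
      ← EReal.exp_coe, EReal.coe_neg, coe_toReal_of_mem_powDomain hφ_bot hyD, mul_assoc]
  · rw [Set.indicator_of_notMem hyD]
    by_cases hyo : y ∈ orthant n
    · have : φ (powMap n k y) = ⊤ := by
        by_contra hne
        exact hy ⟨⟨hyo, lt_top_iff_ne_top.2 hne⟩, hyD⟩
      rw [Set.indicator_of_mem hyo, Pi.mul_apply, this]
      simp
    · rw [Set.indicator_of_notMem hyo]

theorem map_powMap_powMeasure (hk : 1 < k) (hφ : IsPConvex (1 / (k : ℝ)) φ)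
    (hφ_bot : ∀ x ∈ orthant n, φ x ≠ ⊥) :
    (powMeasure k (powDomain k φ) fun y => (φ (powMap n k y)).toReal).map (powMap n k) =
      expMeasure φ := by
  ext s hs
  have hm : Measurable (powMap n k) := contDiff_powMap.continuous.measurable
  rw [← lintegral_indicator_one hs, ← lintegral_indicator_one hs,
    lintegral_expMeasure hk hφ hφ_bot, lintegral_map (measurable_one.indicator hs) hm]

theorem exists_lipschitzOnWith_comp_powMap {f : (Fin n → ℝ) → ℝ}
    (hf : LocallyLipschitzOn (orthant n) f) {a : ℝ} (b : ℝ) (ha : 0 < a) :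
    ∃ M, LipschitzOnWith M (fun y => f (powMap n k y)) (Set.Icc (fun _ => a) (fun _ => b)) := by
  set Q : Set (Fin n → ℝ) := Set.Icc (fun _ => a) (fun _ => b)
  have hQ : IsCompact Q := isCompact_Icc
  have hsub : powMap n k '' Q ⊆ orthant n := by
    rintro _ ⟨y, hy, rfl⟩
    exact powMap_mem_orthant fun i => ha.trans_le (hy.1 i)
  obtain ⟨K₁, h1⟩ := (contDiff_powMap (n := n) (k := k)).locallyLipschitz.locallyLipschitzOn
    |>.exists_lipschitzOnWith_of_compact hQ
  obtain ⟨K₂, h2⟩ := (hf.mono hsub).exists_lipschitzOnWith_of_compact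
    (hQ.image contDiff_powMap.continuous)
  exact ⟨_, h2.comp h1 (Set.mapsTo_image _ _)⟩

end ChangeOfVariables

/-! ### The weighted Poincaré inequality. -/

theorem theorem1p1 (n k : ℕ) (hn : 1 ≤ n) (hk : 1 < k)
    (φ : (Fin n → ℝ) → EReal) (hφ_bot : ∀ x ∈ orthant n, φ x ≠ ⊥)
    (hφ : IsPConvex (1 / (k : ℝ)) φ)
    (μ : Measure (Fin n → ℝ)) (hμ : μ = expMeasure φ)
    (f : (Fin n → ℝ) → ℝ) (hf_lip : LocallyLipschitzOn (orthant n) f)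
    (hf_int : Integrable f μ) (hf_zero : ∫ x, f x ∂μ = 0) :
    ∫⁻ x, ENNReal.ofReal (f x ^ 2) ∂μ ≤
      ENNReal.ofReal ((k : ℝ) ^ 2 / ((k : ℝ) - 1)) *
        ∑ i, ∫⁻ x, ENNReal.ofReal (x i ^ 2 * |partialDeriv i f x| ^ 2) ∂μ := by
  subst hμ
  have hk0 : k ≠ 0 := by omega
  have hDo : powDomain k φ ⊆ orthant n := powDomain_subset_orthant
  have hD : IsOpen (powDomain k φ) := isOpen_interior
  have hm : AEMeasurable (powMap n k)
      (powMeasure k (powDomain k φ) fun y => (φ (powMap n k y)).toReal) :=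
    contDiff_powMap.continuous.measurable.aemeasurable
  have hmap := map_powMap_powMeasure hk hφ hφ_bot
  have hgi := (integrable_map_measure (by rw [hmap]; exact hf_int.1) hm).1 (by rwa [hmap])
  have hg0 := integral_map hm (f := f) (by rw [hmap]; exact hf_int.1)
  rw [hmap, hf_zero] at hg0
  simp only [lintegral_expMeasure hk hφ hφ_bot]
  set ν := powMeasure k (powDomain k φ) fun y => (φ (powMap n k y)).toReal with hν
  refine (powMeasure_poincare hk hD (convexOn_toReal hφ hφ_bot) hDo
    (fun a b ha => exists_lipschitzOnWith_comp_powMap hf_lip b ha) hgi hg0.symm).trans ?_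
  have hconst : ENNReal.ofReal ((k : ℝ) ^ 2 / ((k : ℝ) - 1)) =
      ENNReal.ofReal (1 / ((k : ℝ) - 1)) * ENNReal.ofReal ((k : ℝ) ^ 2) := by
    rw [← ENNReal.ofReal_mul' (by positivity)]
    congr 1
    ring
  rw [hconst, mul_assoc]
  gcongr
  rw [Finset.mul_sum]
  refine Finset.sum_le_sum fun i _ => ?_
  rw [← lintegral_const_mul' _ _ ENNReal.ofReal_ne_top]
  have hae : ∀ᵐ y ∂ν, y ∈ powDomain k φ := by
    rw [hν, ← powMeasure_restrict_self hD]
    exact ae_restrict_mem hD.measurableSet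
  refine lintegral_mono_ae ?_
  filter_upwards [hae] with y hy
  rw [← ENNReal.ofReal_mul (by positivity), sq_abs]
  refine ENNReal.ofReal_le_ofReal ?_
  -- Where the composite is not differentiable, `fderiv` is zero by convention and the pointwise
  -- bound is trivial, so Rademacher's theorem is not needed here.
  by_cases hd : DifferentiableAt ℝ (fun y => f (powMap n k y)) y
  · rw [lineDeriv_comp_rootMap hk0 (hDo hy) hd]
    exact le_of_eq (by ring)
  · rw [fderiv_zero_of_not_differentiableAt hd]
    simp only [zero_apply, mul_zero, ne_eq, OfNat.ofNat_ne_zero, not_false_eq_true, zero_pow]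
    positivity
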